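/- Let $d\ge 1$, $\Lambda_l=(-l/2,l/2)^d$ and $V_l=l^d$ for $l=1,2,\dots$, and let $v^\omega(x)\ge 0$ be a non-negative (jointly measurable) random potential on $\mathbb R^d$ over a probability space $(\Omega,\mathcal F,\mathbb P)$. On $L^2(\Lambda_l)$ let $h_l^0=-\tfrac12\Delta_D$ be the Dirichlet kinetic-energy operator, with complete orthonormal eigenfunctions $\psi^l_k$ and ordered eigenvalues $\varepsilon^l_k$ (repeated according to multiplicity), and let $h_l^\omega=h_l^0\dotplus v^\omega$ (form sum), with complete orthonormal eigenfunctions $\phi_i^{\omega,l}$ and ordered eigenvalues $E_i^{\omega,l}$. Suppose that almost surely $E_1^{\omega,l}\to 0$ as $l\to\infty$, and let the locally finite non-random measure $\nu$ be the integrated density of states, i.e. almost surely $\frac1{V_l}\#\{i:E_i^{\omega,l}\le x\}\to\nu((-\infty,x])$ at every continuity point $x$. Fix an inverse temperature $\beta>0$ and a mean density $\overline\rho>0$. Let $\langle A\rangle_l=\mathrm{Tr}\,(e^{-\beta H_l(\mu)}A)/\mathrm{Tr}\,e^{-\beta H_l(\mu)}$ be the grand-canonical equilibrium state of the perfect Bose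 gas on the symmetric Fock space over $L^2(\Lambda_l)$, with $H_l(\mu)=\sum_i(E_i^{\omega,l}-\mu)\,a^*(\phi_i)a(\phi_i)$, where $\mu=\mu_l^\omega<E_1^{\omega,l}$ is determined by $\frac1{V_l}\langle N_l\rangle_l=\overline\rho$, $N_l$ being the total particle number. With $N_l(f)=a^*(f)a(f)$, define the occupation measures $$m_l(A)=\frac1{V_l}\sum_{i:\,E_i^{\omega,l}\in A}\langle N_l(\phi_i^{\omega,l})\rangle_l,\qquad \tilde m_l(A)=\frac1{V_l}\sum_{k:\,\varepsilon_k^l\in A}\langle N_l(\psi_k^l)\rangle_l ,$$ and the critical density $\rho_c=\lim_{\mu\uparrow0}\int_{[0,\infty)}\big(e^{\beta(E-\mu)}-1\big)^{-1}\nu(\mathrm dE)\in[0,\infty]$. Then there is a non-random measure $m$ on $\mathbb R$ such that almost surely $m_l\to m$ weakly, and $$m(\{0\})=\begin{cases}\overline\rho-\rho_c,&\overline\rho\ge\rho_c,\\ 0,&\overline\rho<\rho_c.\end{cases}$$ Moreover, almost surely, for every subsequence $(\tilde m_{l_r})_{r}$ that converges weakly (or only vaguely) to a measure $\tilde m$,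 $$\tilde m(\{0\})\ \ge\ m(\{0\}).$$ -/

import Mathlib

open MeasureTheory Filter Topology Set
open scoped ENNReal NNReal

noncomputable section

namespace BoseGas

/-- The open cube `(-l/2, l/2)^d`. -/
def box (d l : ℕ) : Set (EuclideanSpace ℝ (Fin d)) :=
  {x | ∀ j, -((l : ℝ) / 2) < x j ∧ x j < (l : ℝ) / 2}

/-- The volume `l^d` of the cube. -/
def vol (d l : ℕ) : ℝ≥0∞ := (l : ℝ≥0∞) ^ d

/-- Lebesgue measure on the cube. -/
abbrev boxMeasure (d l : ℕ) : Measure (EuclideanSpace ℝ (Fin d)) :=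
  volume.restrict (box d l)

/-- The one-particle Hilbert space `L²(Λ_l)` (complex valued). -/
abbrev OneParticle (d l : ℕ) : Type := Lp ℂ 2 (boxMeasure d l)

/-! ### One-particle operators, as quadratic forms -/

/-- `u` is a smooth function with compact support inside the open cube. -/
def IsTestFunction (d l : ℕ) (u : EuclideanSpace ℝ (Fin d) → ℂ) : Prop :=
  ContDiff ℝ (⊤ : ℕ∞) u ∧ HasCompactSupport u ∧ tsupport u ⊆ box d l

/-- `f` lies in the Sobolev space `H¹₀(Λ_l)`, the closure of the test functions in the `H¹` norm,
and `G j` is its `j`-th weak partial derivative. -/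
def HasDirichletGradient {d l : ℕ} (f : OneParticle d l) (G : Fin d → OneParticle d l) : Prop :=
  ∃ u : ℕ → EuclideanSpace ℝ (Fin d) → ℂ,
    (∀ n, IsTestFunction d l (u n)) ∧
    Tendsto (fun n => eLpNorm (fun x => u n x - f x) 2 (boxMeasure d l)) atTop (𝓝 0) ∧
    ∀ j, Tendsto
      (fun n => eLpNorm (fun x => fderiv ℝ (u n) x (EuclideanSpace.single j 1) - G j x) 2
        (boxMeasure d l)) atTop (𝓝 0)

/-- `f` lies in the form domain of multiplication by `V` on the cube: `∫ V |f|² < ∞`. -/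
def InPotentialDomain {d l : ℕ} (V : EuclideanSpace ℝ (Fin d) → ℝ) (f : OneParticle d l) : Prop :=
  Integrable (fun x => V x * ‖f x‖ ^ 2) (boxMeasure d l)

/-- `f` lies in the domain of the form sum `h = -½ Δ_D ∔ V` on `L²(Λ_l)`, and `h f = g`.
The form domain is `Q = H¹₀(Λ_l) ∩ Q(V)`, the form is
`q(η, f) = ½ ∫ ∇η̄ · ∇f + ∫ V η̄ f`, and `h f = g` means `q(η, f) = (η, g)` for all `η ∈ Q`. -/
def SchrodingerMaps {d l : ℕ} (V : EuclideanSpace ℝ (Fin d) → ℝ) (f g : OneParticle d l) : Prop :=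
  InPotentialDomain V f ∧
  ∃ G : Fin d → OneParticle d l, HasDirichletGradient f G ∧
    ∀ (η : OneParticle d l) (K : Fin d → OneParticle d l),
      HasDirichletGradient η K → InPotentialDomain V η →
        (1 / 2 : ℂ) * ∑ j, inner ℂ (K j) (G j)
          + ∫ x, (V x : ℂ) * (starRingEnd ℂ (η x) * f x) ∂(boxMeasure d l)
        = inner ℂ η g

/-- `(φ i, E i)`, `i = 0, 1, 2, …`, is a complete orthonormal system of eigenfunctions of
`-½ Δ_D ∔ V` on `L²(Λ_l)`, with the eigenvalues in increasing order, repeated according to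
multiplicity. -/
structure IsEigenbasis {d l : ℕ} (V : EuclideanSpace ℝ (Fin d) → ℝ)
    (φ : ℕ → OneParticle d l) (E : ℕ → ℝ) : Prop where
  orthonormal : Orthonormal ℂ φ
  complete : (Submodule.span ℂ (range φ)).topologicalClosure = ⊤
  ordered : Monotone E
  eigen : ∀ i, SchrodingerMaps V (φ i) ((E i : ℂ) • φ i)

/-! ### The perfect Bose gas on the symmetric Fock space

The symmetric Fock space over `L²(Λ_l)` is written in the occupation number representation of an
orthonormal basis `φ` of `L²(Λ_l)`: it has the orthonormal basis `|n⟩`, where `n i` is the number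
of particles in the state `φ i` and `n` has finite support. -/

/-- The symmetric Fock space. -/
abbrev Fock : Type := lp (fun _ : ℕ →₀ ℕ => ℂ) 2

/-- The basis vector `|n⟩`. -/
def ket (n : ℕ →₀ ℕ) : Fock := lp.single 2 n (1 : ℂ)

/-- `a(f) |n⟩`, where `a(φ i) |n⟩ = √(n i) |n - e_i⟩` and `f ↦ a(f)` is conjugate linear, that is
`a(f) = ∑ i, (f, φ i) a(φ i)`. -/
def annihilate {d l : ℕ} (φ : ℕ → OneParticle d l) (f : OneParticle d l) (n : ℕ →₀ ℕ) : Fock :=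
  ∑ i ∈ n.support,
    (inner ℂ f (φ i) * ((Real.sqrt (n i) : ℝ) : ℂ)) • ket (n - Finsupp.single i 1)

/-- The eigenvalue of `H(μ) = ∑ i, (E i - μ) N(φ i)` at `|n⟩`. -/
def manyBodyEnergy (E : ℕ → ℝ) (μ : ℝ) (n : ℕ →₀ ℕ) : ℝ :=
  n.sum fun i k => (k : ℝ) * (E i - μ)

/-- The eigenvalue of `exp (-β H(μ))` at `|n⟩`. -/
def boltzmann (β : ℝ) (E : ℕ → ℝ) (μ : ℝ) (n : ℕ →₀ ℕ) : ℝ≥0∞ :=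
  ENNReal.ofReal (Real.exp (-β * manyBodyEnergy E μ n))

/-- `Tr (exp (-β H(μ)) A) / Tr (exp (-β H(μ)))` for a non-negative observable `A` on Fock space with
diagonal matrix elements `A n = ⟨n| A |n⟩`. -/
def gibbsMean (β : ℝ) (E : ℕ → ℝ) (μ : ℝ) (A : (ℕ →₀ ℕ) → ℝ≥0∞) : ℝ≥0∞ :=
  (∑' n, boltzmann β E μ n * A n) / ∑' n, boltzmann β E μ n

/-- The equilibrium mean `⟨N(f)⟩` of the number operator `N(f) = a*(f) a(f)`, with
`⟨n| a*(f) a(f) |n⟩ = ‖a(f) |n⟩‖²`. -/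
def meanOccupation {d l : ℕ} (β : ℝ) (φ : ℕ → OneParticle d l) (E : ℕ → ℝ) (μ : ℝ)
    (f : OneParticle d l) : ℝ≥0∞ :=
  gibbsMean β E μ fun n => ENNReal.ofReal (‖annihilate φ f n‖ ^ 2)

/-- The equilibrium mean `⟨N⟩` of the total number of particles, `N |n⟩ = (∑ i, n i) |n⟩`. -/
def meanNumber (β : ℝ) (E : ℕ → ℝ) (μ : ℝ) : ℝ≥0∞ :=
  gibbsMean β E μ fun n => ((n.sum fun _ k => k : ℕ) : ℝ≥0∞)

/-- `μ` is the chemical potential at inverse temperature `β` and mean density `ρ` in the cube. -/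
def IsChemicalPotential (d l : ℕ) (β ρ : ℝ) (E : ℕ → ℝ) (μ : ℝ) : Prop :=
  μ < E 0 ∧ meanNumber β E μ / vol d l = ENNReal.ofReal ρ

/-- The occupation measure `A ↦ V_l⁻¹ ∑_{k : e k ∈ A} ⟨N(χ k)⟩` of the states `χ k` with energies
`e k`, in the equilibrium state of the gas whose one-particle eigenfunctions and eigenvalues are
`φ` and `E`. -/
def occupationMeasure {d l : ℕ} (β : ℝ) (φ : ℕ → OneParticle d l) (E : ℕ → ℝ) (μ : ℝ)
    (χ : ℕ → OneParticle d l) (e : ℕ → ℝ) : Measure ℝ :=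
  Measure.sum fun k => (meanOccupation β φ E μ (χ k) / vol d l) • Measure.dirac (e k)

/-! ### Density of states, critical density, convergence of measures -/

/-- The finite-volume integrated density of states `V_l⁻¹ #{i : E i ≤ x}`. -/
def finiteIDS (d l : ℕ) (E : ℕ → ℝ) (x : ℝ) : ℝ≥0∞ :=
  ((Set.encard {i | E i ≤ x} : ℕ∞) : ℝ≥0∞) / vol d l

/-- The locally finite measure `ν` is the limiting integrated density of states of the eigenvalues
`E l i`: `ν_l(x) → ν((-∞, x])` at every `x` that is not an atom of `ν`. -/
def IsLimitingIDS (d : ℕ) (E : ℕ → ℕ → ℝ) (ν : Measure ℝ) : Prop :=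
  IsLocallyFiniteMeasure ν ∧
  ∀ x : ℝ, ν {x} = 0 → Tendsto (fun l => finiteIDS d l (E l) x) atTop (𝓝 (ν (Iic x)))

/-- The critical density `lim_{μ ↑ 0} ∫_{[0,∞)} (e^{β(E - μ)} - 1)⁻¹ ν(dE)`, possibly infinite; the
integral is non-decreasing in `μ < 0`, so that the limit is a supremum. -/
def criticalDensity (β : ℝ) (ν : Measure ℝ) : ℝ≥0∞ :=
  ⨆ (μ : ℝ) (_ : μ < 0),
    ∫⁻ x in Ici (0 : ℝ), ENNReal.ofReal (1 / (Real.exp (β * (x - μ)) - 1)) ∂ν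

/-- Weak convergence of measures on `ℝ` (bounded continuous functions). -/
def WeaklyConverges (κ : ℕ → Measure ℝ) (κ₀ : Measure ℝ) : Prop :=
  ∀ f : ℝ → ℝ≥0, Continuous f → (∃ C, ∀ x, f x ≤ C) →
    Tendsto (fun r => ∫⁻ x, f x ∂(κ r)) atTop (𝓝 (∫⁻ x, f x ∂κ₀))

/-- Vague convergence of measures on `ℝ` (compactly supported continuous functions); it is implied
by weak convergence. -/
def VaguelyConverges (κ : ℕ → Measure ℝ) (κ₀ : Measure ℝ) : Prop :=
  ∀ f : ℝ → ℝ≥0, Continuous f → HasCompactSupport f →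
    Tendsto (fun r => ∫⁻ x, f x ∂(κ r)) atTop (𝓝 (∫⁻ x, f x ∂κ₀))

end BoseGas

end

/-! In the occupation number basis the Gibbs weights are explicit: the mean occupation of `φ i` is
the Bose factor `boseFactor β μ (E i)`, and that of any state `f` is the average of these factors
with weights `|(f, φ i)|²`. Hence `m_l` is the finite-volume density of states `κ_l` multiplied by a
Bose factor, with total mass `ρ`.

Existence of the limit. The main analytic input is a bound on the Laplace transform of `κ_l` by
`(2πt)^(-d/2)`, uniform in `l` and in the potential (`IsEigenbasis.tsum_exp_le`). It comes from
convexity of the exponential on the Fourier side and Bessel's inequality. It controls large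
energies, passes to `ν`, and forces `ν {0} = 0`. For fixed `μ₀ < 0` the integrals against
`boseFactor β μ₀` therefore converge. Bose factors are monotone in the chemical potential, so the
`L¹` distance between two of them is the difference of their masses. Below the critical density one
picks `μ₀ < 0` with mass `ρ` under `ν` and compares (`HeatBound.tendsto_of_subcritical`). Otherwise
one compares with `μ₀ = -s`. Away from zero energy the difference is small with `s`, and the missing
mass `ρ - ρ_c` can only sit at `0` (`HeatBound.tendsto_of_supercritical`). The limit depends only on
`β`, `ρ`, `ν`, so it is non-random.

Kinetic condensation. Since `v ≥ 0`, the kinetic energy of `φ i` is at most `E i`, so by Markov's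
inequality `φ i` has weight at least `1 - E i / γ` on kinetic modes with `ε k ≤ γ`
(`IsEigenbasis.le_tsum_low_modes`). Mass of `m_l` at energies at most `2δ` thus reappears in `m̃_l`
below `γ`, up to the factor `1 - 2δ/γ`. With `δ = γ²` and `γ → 0` after the volume limit, this
compares the atoms (`atom_le_of_lintegral_cutoff`). -/

noncomputable section

namespace BoseGas

/-! ### The grand-canonical trace -/

/-- The Bose–Einstein factor `(e^{β (x - μ)} - 1)⁻¹`. -/
def boseFactor (β μ x : ℝ) : ℝ := 1 / (Real.exp (β * (x - μ)) - 1)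

lemma manyBodyEnergy_add_single (E : ℕ → ℝ) (μ : ℝ) (n : ℕ →₀ ℕ) (i k : ℕ) :
    manyBodyEnergy E μ (n + Finsupp.single i k) = manyBodyEnergy E μ n + k * (E i - μ) := by
  unfold manyBodyEnergy
  rw [Finsupp.sum_add_index', Finsupp.sum_single_index] <;> simp [add_mul]

lemma boltzmann_add_single (β : ℝ) (E : ℕ → ℝ) (μ : ℝ) (n : ℕ →₀ ℕ) (i k : ℕ) :
    boltzmann β E μ (n + Finsupp.single i k)
      = boltzmann β E μ n * ENNReal.ofReal (Real.exp (-(β * (E i - μ)))) ^ k := by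
  unfold boltzmann
  rw [manyBodyEnergy_add_single, ← ENNReal.ofReal_pow (Real.exp_pos _).le,
    ← ENNReal.ofReal_mul (Real.exp_pos _).le, ← Real.exp_nat_mul, ← Real.exp_add]
  congr 2
  ring

/-- Adding `k` particles in mode `i` maps all configurations bijectively onto those with `n i ≥ k`
and multiplies each weight by the same factor. Summed over `k ≥ 1` this gives the mean of `n i` as a
geometric series, without a product formula for the partition function. -/
lemma tsum_boltzmann_indicator (β : ℝ) (E : ℕ → ℝ) (μ : ℝ) (i k : ℕ) :
    ∑' n : ℕ →₀ ℕ, boltzmann β E μ n * (if k ≤ n i then 1 else 0)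
      = (∑' n, boltzmann β E μ n) * ENNReal.ofReal (Real.exp (-(β * (E i - μ)))) ^ k := by
  have hinj : Function.Injective fun n : ℕ →₀ ℕ => n + Finsupp.single i k :=
    fun a b h => add_right_cancel h
  rw [← ENNReal.tsum_mul_right, ← hinj.tsum_eq]
  · refine tsum_congr fun n => ?_
    simp [boltzmann_add_single]
  · intro n hn
    have hk : k ≤ n i := by
      by_contra h
      simp [h] at hn
    refine ⟨n - Finsupp.single i k, ?_⟩
    exact tsub_add_cancel_of_le (Finsupp.single_le_iff.2 hk)

lemma tsum_indicator_succ_le (m : ℕ) :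
    ∑' k : ℕ, (if k + 1 ≤ m then (1 : ℝ≥0∞) else 0) = m := by
  rw [tsum_eq_sum (s := Finset.range m)]
  · rw [Finset.sum_congr rfl (g := fun _ => (1 : ℝ≥0∞))]
    · simp
    · intro k hk
      simp [Nat.succ_le_of_lt (Finset.mem_range.1 hk)]
  · intro k hk
    simp only [Finset.mem_range] at hk
    simp [hk]

lemma tsum_boltzmann_ne_zero (β : ℝ) (E : ℕ → ℝ) (μ : ℝ) :
    ∑' n, boltzmann β E μ n ≠ 0 := by
  intro h
  have := ENNReal.tsum_eq_zero.1 h 0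
  simp [boltzmann, manyBodyEnergy] at this

lemma tsum_pow_succ_eq_boseFactor {y : ℝ} (hy : 0 < y) :
    ∑' k : ℕ, ENNReal.ofReal (Real.exp (-y)) ^ (k + 1)
      = ENNReal.ofReal (1 / (Real.exp y - 1)) := by
  have hlt : Real.exp (-y) < 1 := by simpa using hy
  have hs := (hasSum_geometric_of_lt_one (Real.exp_pos (-y)).le hlt).mul_left (Real.exp (-y))
  have h1 : Real.exp y - 1 ≠ 0 := (sub_pos.2 (by simpa using hy)).ne'
  have h2 : 1 - Real.exp (-y) ≠ 0 := (sub_pos.2 hlt).ne'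
  have heq : Real.exp (-y) * (1 - Real.exp (-y))⁻¹ = 1 / (Real.exp y - 1) := by
    field_simp
    rw [mul_sub, ← Real.exp_add]
    simp
  rw [← heq, ← hs.tsum_eq, ENNReal.ofReal_tsum_of_nonneg _ hs.summable]
  · refine tsum_congr fun k => ?_
    rw [← ENNReal.ofReal_pow (Real.exp_pos _).le, pow_succ']
  · intro k
    positivity

/-- The mean occupation number of a one-particle eigenstate. -/
lemma gibbsMean_occupation {β : ℝ} {E : ℕ → ℝ} {μ : ℝ} (hZ : ∑' n, boltzmann β E μ n ≠ ∞)
    (i : ℕ) (hi : 0 < β * (E i - μ)) :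
    gibbsMean β E μ (fun n => (n i : ℝ≥0∞)) = ENNReal.ofReal (boseFactor β μ (E i)) := by
  unfold gibbsMean
  have : ∑' n : ℕ →₀ ℕ, boltzmann β E μ n * (n i : ℝ≥0∞)
      = (∑' n, boltzmann β E μ n) * ENNReal.ofReal (boseFactor β μ (E i)) := by
    rw [boseFactor, ← tsum_pow_succ_eq_boseFactor hi, ← ENNReal.tsum_mul_left]
    simp_rw [← tsum_boltzmann_indicator]
    rw [ENNReal.tsum_comm]
    refine tsum_congr fun n => ?_
    rw [ENNReal.tsum_mul_left, tsum_indicator_succ_le]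
  rw [this, mul_comm, ENNReal.mul_div_cancel_right (tsum_boltzmann_ne_zero β E μ) hZ]

lemma gibbsMean_tsum (β : ℝ) (E : ℕ → ℝ) (μ : ℝ) (c : ℕ → ℝ≥0∞)
    (A : ℕ → (ℕ →₀ ℕ) → ℝ≥0∞) :
    gibbsMean β E μ (fun n => ∑' i, c i * A i n) = ∑' i, c i * gibbsMean β E μ (A i) := by
  unfold gibbsMean
  simp_rw [div_eq_mul_inv, ← mul_assoc, ENNReal.tsum_mul_right]
  congr 1
  simp_rw [← ENNReal.tsum_mul_left]
  rw [ENNReal.tsum_comm]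
  refine tsum_congr fun i => tsum_congr fun n => ?_
  ring

lemma norm_annihilate_sq {d l : ℕ} (φ : ℕ → OneParticle d l) (f : OneParticle d l)
    (n : ℕ →₀ ℕ) :
    ‖annihilate φ f n‖ ^ 2 = ∑ i ∈ n.support, ‖(inner ℂ f (φ i) : ℂ)‖ ^ 2 * n i := by
  -- Subtraction on `ℕ` is truncated, so distinctness of the configurations `n - e_i` holds only for
  -- occupied modes.
  have hinj : Set.InjOn (fun i => n - Finsupp.single i 1) (n.support : Set ℕ) := by
    intro i hi j hj hij
    by_contra hne
    have hi' : n i ≠ 0 := by simpa using hi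
    have := DFunLike.congr_fun hij i
    simp [Ne.symm hne] at this
    omega
  have h0 : ∀ m m' : ℕ →₀ ℕ, (inner ℂ (ket m) (ket m') : ℂ) = if m = m' then 1 else 0 := by
    intro m m'
    unfold ket
    rw [lp.inner_single_left, lp.single_apply]
    by_cases h : m = m'
    · subst h
      simp
    · simp [h]
  have h2 : (inner ℂ (annihilate φ f n) (annihilate φ f n) : ℂ)
      = ∑ i ∈ n.support, ((‖(inner ℂ f (φ i) : ℂ)‖ ^ 2 * n i : ℝ) : ℂ) := by
    unfold annihilate
    rw [sum_inner]
    refine Finset.sum_congr rfl fun i hi => ?_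
    rw [inner_sum, Finset.sum_eq_single i]
    · rw [inner_smul_left, inner_smul_right, h0, if_pos rfl, mul_one,
        ← Complex.normSq_eq_conj_mul_self, Complex.normSq_eq_norm_sq, norm_mul, mul_pow]
      simp
    · intro j hj hji
      rw [inner_smul_left, inner_smul_right, h0, if_neg]
      · simp
      · intro h
        exact hji (hinj hi hj h).symm
    · exact fun h => absurd hi h
  have h3 := inner_self_eq_norm_sq_to_K (𝕜 := ℂ) (annihilate φ f n)
  rw [h2] at h3
  have h4 := congrArg Complex.re h3
  rw [← Complex.ofReal_sum] at h4
  simp only [Complex.ofReal_re] at h4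
  rw [h4]
  norm_cast

/-- The mean occupation number of an arbitrary one-particle state. -/
lemma meanOccupation_eq {d l : ℕ} {β : ℝ} {φ : ℕ → OneParticle d l} {E : ℕ → ℝ} {μ : ℝ}
    (hZ : ∑' n, boltzmann β E μ n ≠ ∞) (hE : ∀ i, 0 < β * (E i - μ)) (f : OneParticle d l) :
    meanOccupation β φ E μ f
      = ∑' i, ENNReal.ofReal (‖(inner ℂ f (φ i) : ℂ)‖ ^ 2)
          * ENNReal.ofReal (boseFactor β μ (E i)) := by
  unfold meanOccupation
  simp_rw [← gibbsMean_occupation hZ _ (hE _)]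
  rw [← gibbsMean_tsum]
  congr 1
  ext n
  rw [norm_annihilate_sq, tsum_eq_sum (s := n.support),
    ENNReal.ofReal_sum_of_nonneg fun i _ => by positivity]
  · refine Finset.sum_congr rfl fun i _ => ?_
    rw [ENNReal.ofReal_mul (by positivity), ENNReal.ofReal_natCast]
  · intro i hi
    simp [Finsupp.notMem_support_iff.1 hi]

lemma meanNumber_eq {β : ℝ} {E : ℕ → ℝ} {μ : ℝ}
    (hZ : ∑' n, boltzmann β E μ n ≠ ∞) (hE : ∀ i, 0 < β * (E i - μ)) :
    meanNumber β E μ = ∑' i, ENNReal.ofReal (boseFactor β μ (E i)) := by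
  unfold meanNumber
  simp_rw [← gibbsMean_occupation hZ _ (hE _)]
  have := gibbsMean_tsum β E μ (fun _ => 1) (fun i n => (n i : ℝ≥0∞))
  simp only [one_mul] at this
  rw [← this]
  congr 1
  ext n
  rw [tsum_eq_sum (s := n.support)]
  · simp [Finsupp.sum]
  · intro i hi
    simp [Finsupp.notMem_support_iff.1 hi]

/-- In `ℝ≥0∞` division by `∞` gives `0`, so a divergent partition function would make the mean
number vanish. Prescribing a positive density thus already yields a finite trace. -/
lemma tsum_boltzmann_ne_top {β : ℝ} {E : ℕ → ℝ} {μ : ℝ} (h : meanNumber β E μ ≠ 0) :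
    ∑' n, boltzmann β E μ n ≠ ∞ := by
  intro hZ
  exact h (by simp [meanNumber, gibbsMean, hZ])

lemma meanOccupation_eigenfunction {d l : ℕ} {β : ℝ} {φ : ℕ → OneParticle d l} {E : ℕ → ℝ}
    {μ : ℝ} (hZ : ∑' n, boltzmann β E μ n ≠ ∞) (hE : ∀ i, 0 < β * (E i - μ))
    (hφ : Orthonormal ℂ φ) (i : ℕ) :
    meanOccupation β φ E μ (φ i) = ENNReal.ofReal (boseFactor β μ (E i)) := by
  rw [meanOccupation_eq hZ hE, tsum_eq_single i]
  · simp [hφ.1 i]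
  · intro j hj
    simp [hφ.2 hj.symm]

/-! ### Spectral estimates from the quadratic form -/

/-- Testing the eigenvalue equation with the eigenfunction itself. -/
lemma IsEigenbasis.exists_gradient {d l : ℕ} {V : EuclideanSpace ℝ (Fin d) → ℝ}
    (hV : ∀ x, 0 ≤ V x) {φ : ℕ → OneParticle d l} {E : ℕ → ℝ} (h : IsEigenbasis V φ E) (i : ℕ) :
    ∃ G : Fin d → OneParticle d l, HasDirichletGradient (φ i) G ∧
      1 / 2 * ∑ j, ‖G j‖ ^ 2 ≤ E i := by
  obtain ⟨hdom, G, hG, hq⟩ := h.eigen i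
  refine ⟨G, hG, ?_⟩
  have h1 := hq (φ i) G hG hdom
  have h2 : ∫ x, (V x : ℂ) * (starRingEnd ℂ (φ i x) * φ i x) ∂(boxMeasure d l)
      = ((∫ x, V x * ‖φ i x‖ ^ 2 ∂(boxMeasure d l) : ℝ) : ℂ) := by
    rw [← integral_complex_ofReal]
    refine integral_congr_ae (Eventually.of_forall fun x => ?_)
    simp only
    rw [← Complex.normSq_eq_conj_mul_self, Complex.normSq_eq_norm_sq]
    push_cast
    rfl
  -- The potential energy is the part of `E i` that is dropped; this is where the sign of the
  -- potential enters.
  have h3 : 0 ≤ ∫ x, V x * ‖φ i x‖ ^ 2 ∂(boxMeasure d l) :=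
    integral_nonneg fun x => mul_nonneg (hV x) (by positivity)
  have h4 : (1 / 2 : ℂ) * ∑ j, inner ℂ (G j) (G j) = ((1 / 2 * ∑ j, ‖G j‖ ^ 2 : ℝ) : ℂ) := by
    simp_rw [inner_self_eq_norm_sq_to_K]
    push_cast
    rfl
  rw [h2, h4, inner_smul_right, inner_self_eq_norm_sq_to_K, h.orthonormal.1 i] at h1
  have h5 := congrArg Complex.re h1
  simp only [Complex.add_re, Complex.ofReal_re] at h5
  have h6 : ((E i : ℂ) * ((1 : ℝ) : ℂ) ^ 2).re = E i := by simp
  have h7 := h5.trans h6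
  linarith

lemma IsEigenbasis.eigenvalue_nonneg {d l : ℕ} {V : EuclideanSpace ℝ (Fin d) → ℝ}
    (hV : ∀ x, 0 ≤ V x) {φ : ℕ → OneParticle d l} {E : ℕ → ℝ} (h : IsEigenbasis V φ E) (i : ℕ) :
    0 ≤ E i := by
  obtain ⟨G, -, hG⟩ := h.exists_gradient hV i
  exact le_trans (by positivity) hG

/-- Bessel's inequality for an orthogonal, not necessarily normalized, family. -/
lemma sum_mul_norm_sq_le_of_orthogonal {H ι : Type*} [NormedAddCommGroup H]
    [InnerProductSpace ℂ H] [DecidableEq ι] (g : H) (w : ι → H) (a : ι → ℝ) (c : ι → ℂ)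
    (hg : ∀ k, inner ℂ g (w k) = (a k : ℂ) * starRingEnd ℂ (c k))
    (hw : ∀ k k', inner ℂ (w k') (w k) = if k = k' then (a k : ℂ) else 0) (S : Finset ι) :
    ∑ k ∈ S, a k * ‖c k‖ ^ 2 ≤ ‖g‖ ^ 2 := by
  -- Expanding this square avoids dividing by the squared norms `a k`, so vanishing vectors are
  -- allowed.
  have h0 : 0 ≤ ‖g - ∑ k ∈ S, c k • w k‖ ^ 2 := by positivity
  have h1 : inner ℂ g (∑ k ∈ S, c k • w k) = ((∑ k ∈ S, a k * ‖c k‖ ^ 2 : ℝ) : ℂ) := by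
    rw [inner_sum]
    push_cast
    refine Finset.sum_congr rfl fun k _ => ?_
    rw [inner_smul_right, hg, mul_left_comm, Complex.mul_conj, Complex.normSq_eq_norm_sq]
    push_cast
    rfl
  have h2 : inner ℂ (∑ k ∈ S, c k • w k) (∑ k ∈ S, c k • w k)
      = ((∑ k ∈ S, a k * ‖c k‖ ^ 2 : ℝ) : ℂ) := by
    rw [sum_inner]
    push_cast
    refine Finset.sum_congr rfl fun k hk => ?_
    rw [inner_sum, Finset.sum_eq_single k]
    · rw [inner_smul_left, inner_smul_right, hw, if_pos rfl, mul_comm (c k), mul_left_comm,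
        mul_comm _ (c k), Complex.mul_conj, Complex.normSq_eq_norm_sq]
      push_cast
      rfl
    · intro k' _ hk'
      rw [inner_smul_left, inner_smul_right, hw, if_neg hk']
      simp
    · exact fun h => absurd hk h
  have h3 : ‖∑ k ∈ S, c k • w k‖ ^ 2 = ∑ k ∈ S, a k * ‖c k‖ ^ 2 := by
    rw [← inner_self_eq_norm_sq (𝕜 := ℂ), h2]
    exact Complex.ofReal_re _
  rw [@norm_sub_sq ℂ, h1, h3] at h0
  have h4 : RCLike.re ((∑ k ∈ S, a k * ‖c k‖ ^ 2 : ℝ) : ℂ) = ∑ k ∈ S, a k * ‖c k‖ ^ 2 :=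
    Complex.ofReal_re _
  rw [h4] at h0
  linarith

/-- The kinetic energy of `f ∈ H¹₀` dominates `∑ ε_k |(ψ_k, f)|²`. -/
lemma IsEigenbasis.sum_eigenvalue_mul_le {d l : ℕ} {ψ : ℕ → OneParticle d l} {ε : ℕ → ℝ}
    (h : IsEigenbasis (fun _ => 0) ψ ε) {f : OneParticle d l} {G : Fin d → OneParticle d l}
    (hG : HasDirichletGradient f G) (S : Finset ℕ) :
    ∑ k ∈ S, ε k * ‖(inner ℂ f (ψ k) : ℂ)‖ ^ 2 ≤ 1 / 2 * ∑ j, ‖G j‖ ^ 2 := by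
  have hdom : ∀ η : OneParticle d l, InPotentialDomain (fun _ => 0) η := by
    intro η
    simp [InPotentialDomain]
  choose K hK hq using fun k => (h.eigen k).2
  -- The weak eigenvalue equation says that the gradients of the `ψ k` are orthogonal with squared
  -- norms `2 ε k`, and gives the products of any `H¹₀` gradient with them. Bessel's inequality then
  -- applies in the direct sum of `d` copies of `L²`.
  have key : ∀ (η : OneParticle d l) (F : Fin d → OneParticle d l), HasDirichletGradient η F →
      ∀ k, inner ℂ (WithLp.toLp 2 F : PiLp 2 fun _ : Fin d => OneParticle d l)
        (WithLp.toLp 2 (K k)) = ((2 * ε k : ℝ) : ℂ) * inner ℂ η (ψ k) := by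
    intro η F hF k
    have h1 := hq k η F hF (hdom η)
    simp only [Complex.ofReal_zero, zero_mul, integral_zero, add_zero, inner_smul_right] at h1
    rw [PiLp.inner_apply]
    push_cast
    linear_combination 2 * h1
  have := sum_mul_norm_sq_le_of_orthogonal
    (WithLp.toLp 2 G : PiLp 2 fun _ : Fin d => OneParticle d l)
    (fun k => WithLp.toLp 2 (K k)) (fun k => 2 * ε k)
    (fun k => starRingEnd ℂ (inner ℂ f (ψ k)))
    (fun k => by simpa using key f G hG k)
    (fun k k' => by
      rw [key _ _ (hK k') k, orthonormal_iff_ite.1 h.orthonormal k' k]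
      by_cases hkk : k = k'
      · simp [hkk]
      · simp [hkk, Ne.symm hkk]) S
  rw [PiLp.norm_sq_eq_of_L2] at this
  simp only [RCLike.norm_conj, mul_assoc, ← Finset.mul_sum] at this
  linarith

lemma tsum_norm_inner_sq_eq {H : Type*} [NormedAddCommGroup H] [InnerProductSpace ℂ H]
    [CompleteSpace H] {ψ : ℕ → H} (ho : Orthonormal ℂ ψ)
    (hc : (Submodule.span ℂ (range ψ)).topologicalClosure = ⊤) (f : H) :
    ∑' k, ENNReal.ofReal (‖(inner ℂ f (ψ k) : ℂ)‖ ^ 2) = ENNReal.ofReal (‖f‖ ^ 2) := by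
  let b := HilbertBasis.mk ho hc.ge
  have hb : ∀ k, b k = ψ k := fun k => congrFun (HilbertBasis.coe_mk ho hc.ge) k
  have h := b.hasSum_inner_mul_inner f f
  have h1 : HasSum (fun k => ‖(inner ℂ f (ψ k) : ℂ)‖ ^ 2) (‖f‖ ^ 2) := by
    have h2 := Complex.hasSum_re h
    convert! h2 using 1
    · ext k
      rw [hb, ← inner_conj_symm (ψ k) f, Complex.mul_conj, Complex.normSq_eq_norm_sq]
      exact (Complex.ofReal_re _).symm
    · exact (inner_self_eq_norm_sq (𝕜 := ℂ) f).symm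
  rw [← h1.tsum_eq, ENNReal.ofReal_tsum_of_nonneg (fun k => by positivity) h1.summable]

/-- A state with small energy is concentrated on the low kinetic-energy modes. -/
lemma IsEigenbasis.le_tsum_low_modes {d l : ℕ} {V : EuclideanSpace ℝ (Fin d) → ℝ}
    (hV : ∀ x, 0 ≤ V x) {φ : ℕ → OneParticle d l} {E : ℕ → ℝ} (h : IsEigenbasis V φ E)
    {ψ : ℕ → OneParticle d l} {ε : ℕ → ℝ} (h' : IsEigenbasis (fun _ => 0) ψ ε)
    {γ : ℝ} (hγ : 0 < γ) (i : ℕ) :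
    ENNReal.ofReal (1 - E i / γ)
      ≤ ∑' k, ENNReal.ofReal (‖(inner ℂ (ψ k) (φ i) : ℂ)‖ ^ 2) * (Iic γ).indicator 1 (ε k) := by
  obtain ⟨G, hG, hE⟩ := h.exists_gradient hV i
  -- Markov's inequality for the kinetic energy: on the modes counted here `1 < ε k / γ`.
  have hhigh : ∑' k, ENNReal.ofReal (‖(inner ℂ (ψ k) (φ i) : ℂ)‖ ^ 2)
      * (Ioi γ).indicator 1 (ε k) ≤ ENNReal.ofReal (E i / γ) := by
    rw [ENNReal.tsum_eq_iSup_sum]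
    refine iSup_le fun S => ?_
    have h1 := h'.sum_eigenvalue_mul_le hG S
    calc ∑ k ∈ S, ENNReal.ofReal (‖(inner ℂ (ψ k) (φ i) : ℂ)‖ ^ 2) * (Ioi γ).indicator 1 (ε k)
        ≤ ∑ k ∈ S, ENNReal.ofReal (ε k * ‖(inner ℂ (φ i) (ψ k) : ℂ)‖ ^ 2 / γ) := by
          refine Finset.sum_le_sum fun k _ => ?_
          by_cases hk : γ < ε k
          · rw [indicator_of_mem (show ε k ∈ Ioi γ from hk), Pi.one_apply, mul_one,
              norm_inner_symm]
            refine ENNReal.ofReal_le_ofReal ?_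
            rw [le_div_iff₀ hγ, mul_comm]
            gcongr
          · rw [indicator_of_notMem (show ε k ∉ Ioi γ from hk)]
            simp
      _ = ENNReal.ofReal ((∑ k ∈ S, ε k * ‖(inner ℂ (φ i) (ψ k) : ℂ)‖ ^ 2) / γ) := by
          rw [Finset.sum_div, ENNReal.ofReal_sum_of_nonneg]
          intro k _
          have := h'.eigenvalue_nonneg (fun _ => le_rfl) k
          positivity
      _ ≤ ENNReal.ofReal (E i / γ) := by
          refine ENNReal.ofReal_le_ofReal ?_
          gcongr
          linarith
  have htot : 1 = ∑' k, ENNReal.ofReal (‖(inner ℂ (ψ k) (φ i) : ℂ)‖ ^ 2)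
        * (Iic γ).indicator 1 (ε k)
      + ∑' k, ENNReal.ofReal (‖(inner ℂ (ψ k) (φ i) : ℂ)‖ ^ 2) * (Ioi γ).indicator 1 (ε k) := by
    have h1 := tsum_norm_inner_sq_eq h'.orthonormal h'.complete (φ i)
    rw [h.orthonormal.1 i] at h1
    rw [← ENNReal.tsum_add]
    simp only [one_pow, ENNReal.ofReal_one] at h1
    rw [← h1]
    refine tsum_congr fun k => ?_
    rw [norm_inner_symm, ← mul_add, ← compl_Iic, indicator_self_add_compl_apply]
    simp
  rw [ENNReal.ofReal_sub _ (div_nonneg (h.eigenvalue_nonneg hV i) hγ.le), ENNReal.ofReal_one,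
    tsub_le_iff_right]
  nth_rewrite 1 [htot]
  gcongr

/-! ### The heat-trace bound -/

lemma integrable_rexp_neg_mul_sq_norm (d : ℕ) {b : ℝ} (hb : 0 < b) :
    Integrable fun p : EuclideanSpace ℝ (Fin d) => Real.exp (-b * ‖p‖ ^ 2) := by
  refine Integrable.of_integral_ne_zero ?_
  rw [GaussianFourier.integral_rexp_neg_mul_sq_norm hb]
  have := Real.pi_pos
  positivity

open FourierTransform LineDeriv SchwartzMap in
/-- Convexity of the exponential on the Fourier side. -/
lemma exp_mul_le_integral_fourier {d : ℕ} (u : 𝓢(EuclideanSpace ℝ (Fin d), ℂ)) {t : ℝ}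
    (ht : 0 < t) (a : ℝ) :
    Real.exp (-(t * a)) * ((1 + t * a) * (∫ x, ‖u x‖ ^ 2)
        - t / 2 * ∑ j, ∫ x, ‖fderiv ℝ u x (EuclideanSpace.single j 1)‖ ^ 2)
      ≤ ∫ p, Real.exp (-(2 * Real.pi ^ 2 * t) * ‖p‖ ^ 2) * ‖𝓕 (u : _ → ℂ) p‖ ^ 2 := by
  have hint : ∀ g : 𝓢(EuclideanSpace ℝ (Fin d), ℂ), Integrable fun x => ‖g x‖ ^ 2 := fun g =>
    (g.memLp 2 volume).integrable_norm_pow (p := 2) two_ne_zero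
  have h1 : ∀ j : Fin d, ∫ x, ‖fderiv ℝ u x (EuclideanSpace.single j 1)‖ ^ 2
      = ∫ p, ‖𝓕 (∂_{(EuclideanSpace.single j 1 : EuclideanSpace ℝ (Fin d))} u) p‖ ^ 2 := by
    intro j
    rw [integral_norm_sq_fourier]
    rfl
  have h2 : ∀ (j : Fin d) (p : EuclideanSpace ℝ (Fin d)),
      ‖𝓕 (∂_{(EuclideanSpace.single j 1 : EuclideanSpace ℝ (Fin d))} u) p‖ ^ 2
        = 4 * Real.pi ^ 2 * p j ^ 2 * ‖𝓕 u p‖ ^ 2 := by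
    intro j p
    have hT : (inner ℝ · (EuclideanSpace.single j 1 : EuclideanSpace ℝ (Fin d))
        : EuclideanSpace ℝ (Fin d) → ℝ).HasTemperateGrowth :=
      ((innerSL ℝ).flip (EuclideanSpace.single j 1)).hasTemperateGrowth
    rw [fourier_lineDerivOp_eq, smul_apply, smulLeftCLM_apply_apply hT,
      EuclideanSpace.inner_single_right, norm_smul, norm_smul]
    simp only [one_mul, norm_mul, Complex.norm_I, mul_one, Complex.norm_real, Real.norm_eq_abs,
      Complex.norm_ofNat, conj_trivial, mul_pow, sq_abs]
    ring
  rw [← integral_norm_sq_fourier]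
  simp_rw [h1]
  rw [← integral_finsetSum _ fun j _ => hint _, ← integral_const_mul, ← integral_const_mul,
    ← integral_sub ((hint _).const_mul _) ((integrable_finsetSum _ fun j _ => hint _).const_mul _),
    ← integral_const_mul, ← fourier_coe]
  refine integral_mono ?_ ?_ fun p => ?_
  · exact (((hint _).const_mul _).sub
      ((integrable_finsetSum _ fun j _ => hint _).const_mul _)).const_mul _
  · refine (hint (𝓕 u)).bdd_mul (c := 1) (by fun_prop) (Eventually.of_forall fun p => ?_)
    rw [Real.norm_of_nonneg (Real.exp_pos _).le, Real.exp_le_one_iff]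
    have : 0 ≤ 2 * Real.pi ^ 2 * t * ‖p‖ ^ 2 := by positivity
    linarith
  · simp only [h2]
    rw [← Finset.sum_mul, ← Finset.mul_sum, ← EuclideanSpace.real_norm_sq_eq]
    -- `2π²‖p‖²` is the symbol of `-½Δ`. The exponential is bounded below by its tangent at energy
    -- `a`, which is affine in the kinetic energy.
    have h3 := Real.add_one_le_exp (t * a - 2 * Real.pi ^ 2 * t * ‖p‖ ^ 2)
    calc Real.exp (-(t * a)) * ((1 + t * a) * ‖𝓕 u p‖ ^ 2
          - t / 2 * (4 * Real.pi ^ 2 * ‖p‖ ^ 2 * ‖𝓕 u p‖ ^ 2))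
        = Real.exp (-(t * a)) * (t * a - 2 * Real.pi ^ 2 * t * ‖p‖ ^ 2 + 1) * ‖𝓕 u p‖ ^ 2 := by
          ring
      _ ≤ Real.exp (-(t * a)) * Real.exp (t * a - 2 * Real.pi ^ 2 * t * ‖p‖ ^ 2)
          * ‖𝓕 u p‖ ^ 2 := by gcongr
      _ = _ := by
          rw [← Real.exp_add]
          ring_nf

/-! ### Plane waves on the cube and the Fourier transform of `H¹₀` functions -/

lemma volume_box (d l : ℕ) : volume (box d l) = vol d l := by
  have h : box d l = (MeasurableEquiv.toLp 2 (Fin d → ℝ)).symm ⁻¹'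
      (Set.univ.pi fun _ => Ioo (-((l : ℝ) / 2)) ((l : ℝ) / 2)) := by
    ext x
    simp [box]
  rw [h, (EuclideanSpace.volume_preserving_symm_measurableEquiv_toLp (Fin d)).measure_preimage
    (MeasurableSet.univ_pi fun _ => measurableSet_Ioo).nullMeasurableSet, Real.volume_pi_Ioo]
  simp [vol]

lemma vol_ne_top (d l : ℕ) : vol d l ≠ ∞ := by
  simp [vol]

instance (d l : ℕ) : IsFiniteMeasure (boxMeasure d l) :=
  ⟨by rw [Measure.restrict_apply_univ, volume_box]; exact (vol_ne_top d l).lt_top⟩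

lemma memLp_planeWave (d l : ℕ) (p : EuclideanSpace ℝ (Fin d)) :
    MemLp (fun x : EuclideanSpace ℝ (Fin d) => (Real.fourierChar (inner ℝ x p) : ℂ)) 2
      (boxMeasure d l) := by
  refine MemLp.of_bound (Continuous.aestronglyMeasurable (by fun_prop)) 1 ?_
  exact Eventually.of_forall fun x => (Circle.norm_coe _).le

/-- The plane wave `e^{2πi x·p}` on the cube. -/
def planeWave (d l : ℕ) (p : EuclideanSpace ℝ (Fin d)) : OneParticle d l :=
  (memLp_planeWave d l p).toLp _

lemma inner_planeWave {d l : ℕ} (p : EuclideanSpace ℝ (Fin d)) (f : OneParticle d l) :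
    inner ℂ (planeWave d l p) f
      = ∫ x, Real.fourierChar (-inner ℝ x p) • f x ∂(boxMeasure d l) := by
  rw [L2.inner_def]
  refine integral_congr_ae ?_
  filter_upwards [(memLp_planeWave d l p).coeFn_toLp] with x hx
  rw [planeWave, hx, RCLike.inner_apply, Circle.smul_def, AddChar.map_neg_eq_inv,
    Circle.coe_inv_eq_conj, smul_eq_mul, mul_comm]

lemma norm_sq_eq_integral {d l : ℕ} (f : OneParticle d l) :
    ‖f‖ ^ 2 = ∫ x, ‖f x‖ ^ 2 ∂(boxMeasure d l) := by
  rw [← inner_self_eq_norm_sq (𝕜 := ℂ), L2.inner_def]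
  have : ∀ x, inner ℂ (f x) (f x) = ((‖f x‖ ^ 2 : ℝ) : ℂ) := by
    intro x
    rw [inner_self_eq_norm_sq_to_K]
    push_cast
    rfl
  simp_rw [this]
  rw [integral_complex_ofReal]
  exact Complex.ofReal_re _

lemma norm_planeWave_sq (d l : ℕ) (p : EuclideanSpace ℝ (Fin d)) :
    ‖planeWave d l p‖ ^ 2 = (vol d l).toReal := by
  rw [norm_sq_eq_integral]
  have : (fun x => ‖planeWave d l p x‖ ^ 2) =ᵐ[boxMeasure d l] fun _ => (1 : ℝ) := by
    filter_upwards [(memLp_planeWave d l p).coeFn_toLp] with x hx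
    rw [planeWave, hx, Circle.norm_coe, one_pow]
  rw [integral_congr_ae this]
  simp [Measure.real, volume_box]

open FourierTransform in
/-- The kinetic energy of an `H¹₀` function controls its Fourier transform. -/
lemma HasDirichletGradient.exp_mul_le {d l : ℕ} {f : OneParticle d l}
    {G : Fin d → OneParticle d l} (hG : HasDirichletGradient f G) {t : ℝ} (ht : 0 < t) (a : ℝ) :
    (Integrable fun p => Real.exp (-(2 * Real.pi ^ 2 * t) * ‖p‖ ^ 2)
        * ‖(inner ℂ (planeWave d l p) f : ℂ)‖ ^ 2) ∧
    Real.exp (-(t * a)) * ((1 + t * a) * ‖f‖ ^ 2 - t / 2 * ∑ j, ‖G j‖ ^ 2)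
      ≤ ∫ p, Real.exp (-(2 * Real.pi ^ 2 * t) * ‖p‖ ^ 2)
        * ‖(inner ℂ (planeWave d l p) f : ℂ)‖ ^ 2 := by
  obtain ⟨u, hu, hlim, hlimG⟩ := hG
  have hbt : 0 < 2 * Real.pi ^ 2 * t := by positivity
  let U : ℕ → SchwartzMap (EuclideanSpace ℝ (Fin d)) ℂ :=
    fun n => (hu n).2.1.toSchwartzMap (hu n).1
  have hUu : ∀ n x, U n x = u n x := fun n x => rfl
  have hm : ∀ n, MemLp (u n) 2 (boxMeasure d l) := fun n =>
    ((U n).memLp 2 volume).restrict _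
  have hmD : ∀ n (j : Fin d), MemLp (fun x => fderiv ℝ (u n) x (EuclideanSpace.single j 1)) 2
      (boxMeasure d l) := fun n j =>
    ((LineDeriv.lineDerivOp (EuclideanSpace.single j 1 : EuclideanSpace ℝ (Fin d))
      (U n)).memLp 2 volume).restrict _
  have hT : Tendsto (fun n => (hm n).toLp (u n)) atTop (𝓝 f) := by
    have h := (Lp.tendsto_Lp_iff_tendsto_eLpNorm'' u hm f (Lp.memLp f)).2 hlim
    rwa [Lp.toLp_coeFn] at h
  have hTD : ∀ j, Tendsto (fun n => (hmD n j).toLp _) atTop (𝓝 (G j)) := by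
    intro j
    have h := (Lp.tendsto_Lp_iff_tendsto_eLpNorm'' _ (fun n => hmD n j) (G j) (Lp.memLp _)).2
      (hlimG j)
    rwa [Lp.toLp_coeFn] at h
  -- Test functions vanish outside the cube, so their norms over the cube are norms over the whole
  -- space and their Fourier transforms are inner products with plane waves.
  have hsupp : ∀ n x, x ∉ box d l → u n x = 0 := fun n x hx =>
    image_eq_zero_of_notMem_tsupport fun h => hx ((hu n).2.2 h)
  have hsuppD : ∀ n x, x ∉ box d l → fderiv ℝ (u n) x = 0 := fun n x hx =>
    image_eq_zero_of_notMem_tsupport fun h => hx ((hu n).2.2 (tsupport_fderiv_subset ℝ h))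
  have hn : ∀ n, ‖(hm n).toLp (u n)‖ ^ 2 = ∫ x, ‖u n x‖ ^ 2 := by
    intro n
    rw [norm_sq_eq_integral, integral_congr_ae (g := fun x => ‖u n x‖ ^ 2)]
    · refine setIntegral_eq_integral_of_forall_compl_eq_zero fun x hx => ?_
      simp [hsupp n x hx]
    · filter_upwards [(hm n).coeFn_toLp] with x hx
      rw [hx]
  have hnD : ∀ n j, ‖(hmD n j).toLp _‖ ^ 2
      = ∫ x, ‖fderiv ℝ (u n) x (EuclideanSpace.single j 1)‖ ^ 2 := by
    intro n j
    rw [norm_sq_eq_integral,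
      integral_congr_ae (g := fun x => ‖fderiv ℝ (u n) x (EuclideanSpace.single j 1)‖ ^ 2)]
    · refine setIntegral_eq_integral_of_forall_compl_eq_zero fun x hx => ?_
      simp [hsuppD n x hx]
    · filter_upwards [(hmD n j).coeFn_toLp] with x hx
      rw [hx]
  have hF : ∀ n p, 𝓕 (U n : _ → ℂ) p = inner ℂ (planeWave d l p) ((hm n).toLp (u n)) := by
    intro n p
    rw [inner_planeWave, Real.fourier_eq,
      integral_congr_ae (μ := boxMeasure d l)
        (g := fun x => Real.fourierChar (-inner ℝ x p) • u n x)]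
    · refine (setIntegral_eq_integral_of_forall_compl_eq_zero fun x hx => ?_).symm
      rw [hUu, hsupp n x hx, smul_zero]
    · filter_upwards [(hm n).coeFn_toLp] with x hx
      rw [hx]
  have hineq : ∀ n, Real.exp (-(t * a)) * ((1 + t * a) * ‖(hm n).toLp (u n)‖ ^ 2
        - t / 2 * ∑ j, ‖(hmD n j).toLp _‖ ^ 2)
      ≤ ∫ p, Real.exp (-(2 * Real.pi ^ 2 * t) * ‖p‖ ^ 2)
        * ‖(inner ℂ (planeWave d l p) ((hm n).toLp (u n)) : ℂ)‖ ^ 2 := by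
    intro n
    simp_rw [hnD, hn, ← hF]
    exact exp_mul_le_integral_fourier (U n) ht a
  obtain ⟨B, hB⟩ := hT.norm.bddAbove_range
  have hBn : ∀ n, ‖(hm n).toLp (u n)‖ ≤ B := fun n => hB ⟨n, rfl⟩
  have hB0 : 0 ≤ B := (norm_nonneg _).trans (hBn 0)
  -- Cauchy–Schwarz with `‖planeWave‖² = vol` gives a Gaussian majorant independent of `n`, for
  -- dominated convergence.
  have hbound : ∀ n p, ‖Real.exp (-(2 * Real.pi ^ 2 * t) * ‖p‖ ^ 2)
        * ‖(inner ℂ (planeWave d l p) ((hm n).toLp (u n)) : ℂ)‖ ^ 2‖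
      ≤ Real.exp (-(2 * Real.pi ^ 2 * t) * ‖p‖ ^ 2) * ((vol d l).toReal * B ^ 2) := by
    intro n p
    rw [Real.norm_of_nonneg (by positivity)]
    gcongr
    rw [← norm_planeWave_sq d l p, ← mul_pow]
    gcongr
    exact (norm_inner_le_norm _ _).trans (by gcongr; exact hBn n)
  have hmeas : ∀ n, AEStronglyMeasurable (fun p => Real.exp (-(2 * Real.pi ^ 2 * t) * ‖p‖ ^ 2)
        * ‖(inner ℂ (planeWave d l p) ((hm n).toLp (u n)) : ℂ)‖ ^ 2) volume := by
    intro n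
    simp_rw [← hF]
    have : Continuous (𝓕 (U n : _ → ℂ)) := (𝓕 (U n)).continuous
    exact Continuous.aestronglyMeasurable (by fun_prop)
  have hpt : ∀ p, Tendsto (fun n => Real.exp (-(2 * Real.pi ^ 2 * t) * ‖p‖ ^ 2)
        * ‖(inner ℂ (planeWave d l p) ((hm n).toLp (u n)) : ℂ)‖ ^ 2) atTop
      (𝓝 (Real.exp (-(2 * Real.pi ^ 2 * t) * ‖p‖ ^ 2)
        * ‖(inner ℂ (planeWave d l p) f : ℂ)‖ ^ 2)) := fun p =>
    ((tendsto_const_nhds.inner hT).norm.pow 2).const_mul _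
  have hbi : Integrable fun p : EuclideanSpace ℝ (Fin d) =>
      Real.exp (-(2 * Real.pi ^ 2 * t) * ‖p‖ ^ 2) * ((vol d l).toReal * B ^ 2) :=
    (integrable_rexp_neg_mul_sq_norm d hbt).mul_const _
  refine ⟨?_, ?_⟩
  · refine hbi.mono' (aestronglyMeasurable_of_tendsto_ae atTop hmeas
      (Eventually.of_forall hpt)) (Eventually.of_forall fun p => ?_)
    exact le_of_tendsto (hpt p).norm (Eventually.of_forall fun n => hbound n p)
  · refine le_of_tendsto_of_tendsto' ?_ (tendsto_integral_of_dominated_convergence _ hmeas hbi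
      (fun n => Eventually.of_forall (hbound n)) (Eventually.of_forall hpt)) hineq
    refine Tendsto.const_mul _ (((hT.norm.pow 2).const_mul _).sub (Tendsto.const_mul _ ?_))
    exact tendsto_finsetSum _ fun j _ => (hTD j).norm.pow 2

/-- The constant in the heat-trace bound. -/
def heatConst (d : ℕ) (t : ℝ) : ℝ := (Real.pi / (2 * Real.pi ^ 2 * t)) ^ ((d : ℝ) / 2)

/-- For the tangent point `a = E i` the affine lower bound is at least `1`, because the kinetic
energy of `φ i` is at most `E i`. After summing over `i`, Bessel's inequality for a plane wave
against the `φ i` leaves the volume times a Gaussian integral. Neither `V` nor `l` enters the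
constant. -/
lemma IsEigenbasis.tsum_exp_le {d l : ℕ} {V : EuclideanSpace ℝ (Fin d) → ℝ}
    (hV : ∀ x, 0 ≤ V x) {φ : ℕ → OneParticle d l} {E : ℕ → ℝ} (h : IsEigenbasis V φ E)
    {t : ℝ} (ht : 0 < t) :
    ∑' i, ENNReal.ofReal (Real.exp (-(t * E i))) ≤ vol d l * ENNReal.ofReal (heatConst d t) := by
  have hbt : 0 < 2 * Real.pi ^ 2 * t := by positivity
  choose G hG hE using h.exists_gradient hV
  rw [ENNReal.tsum_eq_iSup_sum]
  refine iSup_le fun S => ?_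
  rw [← ENNReal.ofReal_sum_of_nonneg fun i _ => (Real.exp_pos _).le,
    ← ENNReal.ofReal_toReal (vol_ne_top d l), ← ENNReal.ofReal_mul ENNReal.toReal_nonneg]
  refine ENNReal.ofReal_le_ofReal ?_
  calc ∑ i ∈ S, Real.exp (-(t * E i))
      ≤ ∑ i ∈ S, ∫ p, Real.exp (-(2 * Real.pi ^ 2 * t) * ‖p‖ ^ 2)
        * ‖(inner ℂ (planeWave d l p) (φ i) : ℂ)‖ ^ 2 := by
        refine Finset.sum_le_sum fun i _ => le_trans ?_ ((hG i).exp_mul_le ht (E i)).2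
        rw [h.orthonormal.1 i]
        refine le_mul_of_one_le_right (Real.exp_pos _).le ?_
        nlinarith [hE i]
    _ = ∫ p, ∑ i ∈ S, Real.exp (-(2 * Real.pi ^ 2 * t) * ‖p‖ ^ 2)
        * ‖(inner ℂ (planeWave d l p) (φ i) : ℂ)‖ ^ 2 :=
        (integral_finsetSum _ fun i _ => ((hG i).exp_mul_le ht (E i)).1).symm
    _ ≤ ∫ p : EuclideanSpace ℝ (Fin d), Real.exp (-(2 * Real.pi ^ 2 * t) * ‖p‖ ^ 2)
        * (vol d l).toReal := by
        refine integral_mono (integrable_finsetSum _ fun i _ => ((hG i).exp_mul_le ht (E i)).1)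
          ((integrable_rexp_neg_mul_sq_norm d hbt).mul_const _) fun p => ?_
        simp only
        rw [← Finset.mul_sum, ← norm_planeWave_sq d l p]
        gcongr
        simp_rw [norm_inner_symm (planeWave d l p)]
        exact h.orthonormal.sum_inner_products_le _
    _ = (vol d l).toReal * heatConst d t := by
        rw [integral_mul_const, GaussianFourier.integral_rexp_neg_mul_sq_norm hbt, mul_comm]
        simp [heatConst]

lemma tendsto_heatConst {d : ℕ} (hd : 1 ≤ d) : Tendsto (heatConst d) atTop (𝓝 0) := by
  have h1 : Tendsto (fun t : ℝ => Real.pi / (2 * Real.pi ^ 2 * t)) atTop (𝓝 0) :=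
    Tendsto.div_atTop tendsto_const_nhds
      (Tendsto.const_mul_atTop (by positivity) tendsto_id)
  have hd' : (0 : ℝ) < (d : ℝ) / 2 := by
    have : (1 : ℝ) ≤ d := by exact_mod_cast hd
    linarith
  have h2 := h1.rpow_const (p := (d : ℝ) / 2) (Or.inr hd'.le)
  rwa [Real.zero_rpow hd'.ne'] at h2

/-! ### Convergence of integrals against measures with bounded Laplace transforms -/

/-- `κ` lives on `[0, ∞)` and its Laplace transform is dominated by `C`. -/
structure HeatBound (C : ℝ → ℝ) (κ : Measure ℝ) : Prop where
  const_nonneg : ∀ t, 0 < t → 0 ≤ C t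
  neg : κ (Iio 0) = 0
  heat : ∀ t, 0 < t → ∫⁻ x, ENNReal.ofReal (Real.exp (-(t * x))) ∂κ ≤ ENNReal.ofReal (C t)

namespace HeatBound

variable {C : ℝ → ℝ} {κ : Measure ℝ}

lemma ae_nonneg (h : HeatBound C κ) : ∀ᵐ x ∂κ, 0 ≤ x := by
  rw [ae_iff]
  convert! h.neg using 2
  ext x
  simp

lemma integrable_exp (h : HeatBound C κ) {t : ℝ} (ht : 0 < t) :
    Integrable (fun x => Real.exp (-(t * x))) κ := by
  refine ⟨by fun_prop, ?_⟩
  rw [hasFiniteIntegral_iff_ofReal (Eventually.of_forall fun x => (Real.exp_pos _).le)]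
  exact (h.heat t ht).trans_lt ENNReal.ofReal_lt_top

lemma integral_exp_le (h : HeatBound C κ) {t : ℝ} (ht : 0 < t) :
    ∫ x, Real.exp (-(t * x)) ∂κ ≤ C t := by
  rw [← ENNReal.ofReal_le_ofReal_iff (h.const_nonneg t ht),
    ofReal_integral_eq_lintegral_ofReal (h.integrable_exp ht)
      (Eventually.of_forall fun x => (Real.exp_pos _).le)]
  exact h.heat t ht

lemma measure_Iic_le (h : HeatBound C κ) {t : ℝ} (ht : 0 < t) (x : ℝ) :
    κ (Iic x) ≤ ENNReal.ofReal (Real.exp (t * x) * C t) := by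
  have h1 : ENNReal.ofReal (Real.exp (-(t * x))) * κ (Iic x) ≤ ENNReal.ofReal (C t) := by
    refine le_trans ?_ (h.heat t ht)
    refine le_trans (mul_le_mul_right (measure_mono fun y hy => ?_) _)
      (mul_meas_ge_le_lintegral (by fun_prop) _)
    exact ENNReal.ofReal_le_ofReal (Real.exp_le_exp.2 (by
      have := mul_le_mul_of_nonneg_left (show y ≤ x from hy) ht.le
      linarith))
  calc κ (Iic x) = ENNReal.ofReal (Real.exp (t * x))
        * (ENNReal.ofReal (Real.exp (-(t * x))) * κ (Iic x)) := by
        rw [← mul_assoc, ← ENNReal.ofReal_mul (Real.exp_pos _).le, ← Real.exp_add]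
        simp
    _ ≤ _ := by
        rw [ENNReal.ofReal_mul (Real.exp_pos _).le]
        gcongr

lemma measure_Iic_ne_top (h : HeatBound C κ) (x : ℝ) : κ (Iic x) ≠ ∞ :=
  ((h.measure_Iic_le one_pos x).trans_lt ENNReal.ofReal_lt_top).ne

lemma integrable_of_bound (h : HeatBound C κ) {t K : ℝ} (ht : 0 < t) {f : ℝ → ℝ}
    (hf : AEStronglyMeasurable f κ) (hK : ∀ x, 0 ≤ x → |f x| ≤ K * Real.exp (-(t * x))) :
    Integrable f κ := by
  refine ((h.integrable_exp ht).const_mul K).mono' hf ?_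
  filter_upwards [h.ae_nonneg] with x hx
  exact hK x hx

lemma abs_integral_le (h : HeatBound C κ) {t K : ℝ} (ht : 0 < t) (hK0 : 0 ≤ K) {f : ℝ → ℝ}
    (hK : ∀ x, 0 ≤ x → |f x| ≤ K * Real.exp (-(t * x))) : |∫ x, f x ∂κ| ≤ K * C t := by
  calc |∫ x, f x ∂κ| ≤ ∫ x, K * Real.exp (-(t * x)) ∂κ := by
        rw [← Real.norm_eq_abs]
        refine norm_integral_le_of_norm_le ((h.integrable_exp ht).const_mul K) ?_
        filter_upwards [h.ae_nonneg] with x hx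
        exact hK x hx
    _ ≤ K * C t := by
        rw [integral_const_mul]
        gcongr
        exact h.integral_exp_le ht

/-- The contribution of large energies. -/
lemma abs_integral_sub_setIntegral_le (h : HeatBound C κ) {t K : ℝ} (ht : 0 < t) (hK0 : 0 ≤ K)
    {f : ℝ → ℝ} (hf : Measurable f) (hK : ∀ x, 0 ≤ x → |f x| ≤ K * Real.exp (-(t * x)))
    {a M : ℝ} (ha : a < 0) :
    |∫ x, f x ∂κ - ∫ x in Ioc a M, f x ∂κ| ≤ K * Real.exp (-(t / 2 * M)) * C (t / 2) := by
  rw [← integral_indicator measurableSet_Ioc, ← integral_sub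
    (h.integrable_of_bound ht hf.aestronglyMeasurable hK)
    ((h.integrable_of_bound ht hf.aestronglyMeasurable hK).indicator measurableSet_Ioc)]
  -- Beyond `M` half of the decay rate yields the small factor `exp (-(t/2) M)`; the other half
  -- stays for the Laplace bound.
  refine h.abs_integral_le (half_pos ht) (by positivity) fun x hx => ?_
  by_cases hxM : x ≤ M
  · rw [indicator_of_mem (show x ∈ Ioc a M from ⟨ha.trans_le hx, hxM⟩), sub_self, abs_zero]
    positivity
  · rw [indicator_of_notMem (show x ∉ Ioc a M from fun hm => hxM hm.2), sub_zero, mul_assoc, ← Real.exp_add]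
    refine (hK x hx).trans ?_
    gcongr
    nlinarith

end HeatBound

/-- A locally finite measure on `ℝ` has countably many atoms, so cut points can always be chosen
where the distribution functions converge. -/
lemma exists_nonatom_between (ν : Measure ℝ) [IsLocallyFiniteMeasure ν] {a b : ℝ} (hab : a < b) :
    ∃ c, ν {c} = 0 ∧ a < c ∧ c < b := by
  have h : {t : ℝ | 0 < ν {x | id x = t}}.Countable :=
    Measure.countable_meas_level_set_pos measurable_id
  obtain ⟨c, hc, hac, hcb⟩ := (h.dense_compl ℝ).exists_between hab
  refine ⟨c, ?_, hac, hcb⟩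
  simpa using hc

/-- Convergence of distribution functions off the atoms of the limit implies convergence of the
integrals of continuous functions over bounded intervals. -/
lemma tendsto_setIntegral_Ioc {κ : ℕ → Measure ℝ} {ν : Measure ℝ} [IsLocallyFiniteMeasure ν]
    (hκ : ∀ n x, κ n (Iic x) ≠ ∞) (hν : ∀ x, ν (Iic x) ≠ ∞)
    (hlim : ∀ x, ν {x} = 0 → Tendsto (fun n => κ n (Iic x)) atTop (𝓝 (ν (Iic x))))
    {f : ℝ → ℝ} (hf : Continuous f) {a b : ℝ} (ha : ν {a} = 0) (hb : ν {b} = 0) (hab : a ≤ b) :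
    Tendsto (fun n => ∫ x in Ioc a b, f x ∂κ n) atTop (𝓝 (∫ x in Ioc a b, f x ∂ν)) := by
  have hreal : ∀ (m : Measure ℝ), (∀ x, m (Iic x) ≠ ∞) → ∀ p q : ℝ, p ≤ q →
      m.real (Ioc p q) = m.real (Iic q) - m.real (Iic p) := by
    intro m hm p q hpq
    rw [← Iic_sdiff_Iic, measureReal_sdiff (Iic_subset_Iic.2 hpq) measurableSet_Iic (hm q)]
  have hI : ∀ p q, p ≤ q → ν {p} = 0 → ν {q} = 0 →
      Tendsto (fun n => (κ n).real (Ioc p q)) atTop (𝓝 (ν.real (Ioc p q))) := by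
    intro p q hpq hp hq
    simp_rw [hreal ν hν p q hpq, fun n => hreal (κ n) (hκ n) p q hpq]
    exact ((ENNReal.tendsto_toReal (hν q)).comp (hlim q hq)).sub
      ((ENNReal.tendsto_toReal (hν p)).comp (hlim p hp))
  have hfin : ∀ (m : Measure ℝ), (∀ x, m (Iic x) ≠ ∞) → ∀ p q : ℝ, m (Ioc p q) < ∞ :=
    fun m hm p q => (measure_mono Ioc_subset_Iic_self).trans_lt (hm q).lt_top
  have hint : ∀ (m : Measure ℝ), (∀ x, m (Iic x) ≠ ∞) → ∀ p q : ℝ,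
      IntegrableOn f (Ioc p q) m := by
    intro m hm p q
    obtain ⟨B, hB⟩ := (isCompact_Icc (a := p) (b := q)).exists_bound_of_continuousOn
      hf.continuousOn
    refine Measure.integrableOn_of_bounded (M := B) (hfin m hm p q).ne
      hf.aestronglyMeasurable ?_
    exact (ae_restrict_iff' measurableSet_Ioc).2
      (Eventually.of_forall fun x hx => hB x (Ioc_subset_Icc_self hx))
  have hdev : ∀ (m : Measure ℝ), (∀ x, m (Iic x) ≠ ∞) → ∀ p q ε : ℝ,
      (∀ x ∈ Ioc p q, |f x - f q| ≤ ε) →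
      |∫ x in Ioc p q, f x ∂m - f q * m.real (Ioc p q)| ≤ ε * m.real (Ioc p q) := by
    intro m hm p q ε h
    have h1 : f q * m.real (Ioc p q) = ∫ _ in Ioc p q, f q ∂m := by
      rw [setIntegral_const, smul_eq_mul, mul_comm]
    rw [h1, ← integral_sub (hint m hm p q) (integrableOn_const (hfin m hm p q).ne),
      ← Real.norm_eq_abs]
    exact norm_setIntegral_le_of_norm_le_const (hfin m hm p q) fun x hx => h x hx
  -- On a short interval `f` is within `ε` of its value at the right endpoint, so only interval
  -- masses matter there. The `κ n` mass in the error is exchanged for the `ν` mass, which gives `2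
  -- * ε`, at the cost of a null sequence.
  have key : ∀ ε, 0 < ε → ∃ r : ℕ → ℝ, Tendsto r atTop (𝓝 0) ∧ ∀ n,
      |∫ x in Ioc a b, f x ∂κ n - ∫ x in Ioc a b, f x ∂ν| ≤ 2 * ε * ν.real (Ioc a b) + r n := by
    intro ε hε
    obtain ⟨δ, hδ, hu⟩ := Metric.uniformContinuousOn_iff.1
      ((isCompact_Icc (a := a) (b := b)).uniformContinuousOn_of_continuous hf.continuousOn) ε hε
    have hsmall : ∀ p q, a ≤ p → p ≤ q → q ≤ b → q - p < δ → ν {p} = 0 → ν {q} = 0 →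
        ∃ r : ℕ → ℝ, Tendsto r atTop (𝓝 0) ∧ ∀ n,
        |∫ x in Ioc p q, f x ∂κ n - ∫ x in Ioc p q, f x ∂ν|
          ≤ 2 * ε * ν.real (Ioc p q) + r n := by
      intro p q hap hpq hqb hd hp hq
      have hI' := (hI p q hpq hp hq).sub_const (ν.real (Ioc p q))
      rw [sub_self] at hI'
      refine ⟨fun n => ε * ((κ n).real (Ioc p q) - ν.real (Ioc p q))
        + |f q| * |(κ n).real (Ioc p q) - ν.real (Ioc p q)|, ?_, fun n => ?_⟩
      · simpa using (hI'.const_mul ε).add (hI'.abs.const_mul |f q|)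
      · have hosc : ∀ x ∈ Ioc p q, |f x - f q| ≤ ε := by
          intro x hx
          refine (hu x ⟨hap.trans hx.1.le, hx.2.trans hqb⟩ q ⟨hap.trans hpq, hqb⟩ ?_).le
          rw [Real.dist_eq, abs_sub_comm, abs_of_nonneg (by linarith [hx.2])]
          linarith [hx.1]
        have h1 := abs_le.1 (hdev (κ n) (hκ n) p q ε hosc)
        have h2 := abs_le.1 (hdev ν hν p q ε hosc)
        have h3 := abs_le.1 (abs_mul (f q) ((κ n).real (Ioc p q) - ν.real (Ioc p q))).le
        rw [abs_le]
        constructor <;> nlinarith [h1.1, h1.2, h2.1, h2.2, h3.1, h3.2]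
    have hind : ∀ N : ℕ, ∀ q, a ≤ q → q ≤ b → ν {q} = 0 → q - a ≤ N * (δ / 2) →
        ∃ r : ℕ → ℝ, Tendsto r atTop (𝓝 0) ∧ ∀ n,
        |∫ x in Ioc a q, f x ∂κ n - ∫ x in Ioc a q, f x ∂ν|
          ≤ 2 * ε * ν.real (Ioc a q) + r n := by
      intro N
      induction N with
      | zero =>
        intro q haq hqb hq hN
        refine hsmall a q le_rfl haq hqb ?_ ha hq
        simp only [Nat.cast_zero, zero_mul] at hN
        linarith
      | succ N ih =>
        intro q haq hqb hq hN
        by_cases hlt : q - a < δ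
        · exact hsmall a q le_rfl haq hqb hlt ha hq
        -- A non-atomic cut at distance between `δ/2` and `δ` from `q`: close enough for the
        -- oscillation bound, far enough to use up one step of the induction.
        · obtain ⟨c, hc, hc1, hc2⟩ := exists_nonatom_between ν
            (show q - δ < q - δ / 2 by linarith)
          have hac : a ≤ c := by linarith
          have hcq : c ≤ q := by linarith
          push_cast at hN
          obtain ⟨r₁, hr₁, h₁⟩ := ih c hac (hcq.trans hqb) hc (by linarith)
          obtain ⟨r₂, hr₂, h₂⟩ := hsmall c q hac hcq hqb (by linarith) hc hq
          refine ⟨fun n => r₁ n + r₂ n, by simpa using hr₁.add hr₂, fun n => ?_⟩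
          have hsplit : ∀ (m : Measure ℝ), (∀ x, m (Iic x) ≠ ∞) →
              ∫ x in Ioc a q, f x ∂m = ∫ x in Ioc a c, f x ∂m + ∫ x in Ioc c q, f x ∂m := by
            intro m hm
            rw [← Ioc_union_Ioc_eq_Ioc hac hcq, setIntegral_union
              (Ioc_disjoint_Ioc_of_le le_rfl) measurableSet_Ioc (hint m hm _ _) (hint m hm _ _)]
          rw [hsplit (κ n) (hκ n), hsplit ν hν]
          have hadd : ν.real (Ioc a q) = ν.real (Ioc a c) + ν.real (Ioc c q) := by
            rw [hreal ν hν a q haq, hreal ν hν a c hac, hreal ν hν c q hcq]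
            ring
          have e₁ := abs_le.1 (h₁ n)
          have e₂ := abs_le.1 (h₂ n)
          rw [hadd, abs_le]
          constructor <;> linarith [e₁.1, e₁.2, e₂.1, e₂.2]
    obtain ⟨N, hN⟩ := exists_nat_ge ((b - a) / (δ / 2))
    exact hind N b hab le_rfl hb ((div_le_iff₀ (half_pos hδ)).1 hN)
  rw [Metric.tendsto_nhds]
  intro η hη
  have hM : 0 ≤ ν.real (Ioc a b) := measureReal_nonneg
  obtain ⟨r, hr, h⟩ := key (η / (4 * (ν.real (Ioc a b) + 1))) (by positivity)
  filter_upwards [hr.eventually (gt_mem_nhds (half_pos hη))] with n hn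
  rw [Real.dist_eq]
  refine (h n).trans_lt ?_
  have : 2 * (η / (4 * (ν.real (Ioc a b) + 1))) * ν.real (Ioc a b) ≤ η / 2 := by
    rw [← mul_div_assoc, div_mul_eq_mul_div, div_le_div_iff₀ (by positivity) two_pos]
    nlinarith
  linarith

/-- The bounds survive the limit on intervals with non-atomic endpoints, and such intervals exhaust
the line. -/
lemma HeatBound.of_tendsto {C : ℝ → ℝ} {κ : ℕ → Measure ℝ} {ν : Measure ℝ}
    [IsLocallyFiniteMeasure ν] (hκ : ∀ n, HeatBound C (κ n))
    (hlim : ∀ x, ν {x} = 0 → Tendsto (fun n => κ n (Iic x)) atTop (𝓝 (ν (Iic x)))) :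
    HeatBound C ν := by
  have hν : ∀ x, ν (Iic x) ≠ ∞ := by
    intro x
    obtain ⟨c, hc, hc1, -⟩ := exists_nonatom_between ν (lt_add_one x)
    refine ((measure_mono (Iic_subset_Iic.2 hc1.le)).trans_lt ?_).ne
    exact (le_of_tendsto' (hlim c hc) fun n => (hκ n).measure_Iic_le one_pos c).trans_lt
      ENNReal.ofReal_lt_top
  refine ⟨(hκ 0).const_nonneg, ?_, fun t ht => ?_⟩
  · have h0 : ∀ x < 0, ν (Iic x) = 0 := by
      intro x hx
      obtain ⟨c, hc, hc1, hc2⟩ := exists_nonatom_between ν hx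
      refine measure_mono_null (Iic_subset_Iic.2 hc1.le) (tendsto_nhds_unique (hlim c hc) ?_)
      have : ∀ n, κ n (Iic c) = 0 := fun n =>
        measure_mono_null (fun y hy => lt_of_le_of_lt hy hc2) (hκ n).neg
      simp [this]
    have : Iio (0 : ℝ) = ⋃ k : ℕ, Iic (-(1 / ((k : ℝ) + 1))) := by
      ext x
      simp only [mem_Iio, mem_iUnion, mem_Iic]
      constructor
      · intro hx
        obtain ⟨k, hk⟩ := exists_nat_one_div_lt (neg_pos.2 hx)
        exact ⟨k, by linarith⟩
      · rintro ⟨k, hk⟩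
        have : 0 < 1 / ((k : ℝ) + 1) := by positivity
        linarith
    rw [this]
    refine measure_iUnion_null fun k => h0 _ ?_
    have : 0 < 1 / ((k : ℝ) + 1) := by positivity
    linarith
  · choose b hb hb1 _ using fun k : ℕ => exists_nonatom_between ν (lt_add_one (k : ℝ))
    choose a ha _ ha2 using fun k : ℕ => exists_nonatom_between ν (sub_one_lt (-(k : ℝ)))
    have hbt : Tendsto b atTop atTop :=
      tendsto_atTop_mono (fun k => (hb1 k).le) tendsto_natCast_atTop_atTop
    have hat : Tendsto a atTop atBot :=
      tendsto_atBot_mono (fun k => (ha2 k).le)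
        (tendsto_neg_atTop_atBot.comp tendsto_natCast_atTop_atTop)
    have hcov := aecover_Ioc (μ := ν) hat hbt
    refine le_of_tendsto' (hcov.lintegral_tendsto_of_countably_generated (by fun_prop)) fun k => ?_
    have hab : a k ≤ b k := by
      have := ha2 k
      have := hb1 k
      have : (0 : ℝ) ≤ k := k.cast_nonneg
      linarith
    have hcont : Continuous fun x : ℝ => Real.exp (-(t * x)) := by fun_prop
    have hl := tendsto_setIntegral_Ioc (fun n => (hκ n).measure_Iic_ne_top) hν hlim hcont
      (ha k) (hb k) hab
    have hle : ∫ x in Ioc (a k) (b k), Real.exp (-(t * x)) ∂ν ≤ C t :=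
      le_of_tendsto' hl fun n => (setIntegral_le_integral ((hκ n).integrable_exp ht)
        (Eventually.of_forall fun x => (Real.exp_pos _).le)).trans ((hκ n).integral_exp_le ht)
    rw [← ofReal_integral_eq_lintegral_ofReal _
      (Eventually.of_forall fun x => (Real.exp_pos _).le)]
    · exact ENNReal.ofReal_le_ofReal hle
    · refine Measure.integrableOn_of_bounded (M := Real.exp (-(t * a k)))
        (((measure_mono Ioc_subset_Iic_self).trans_lt (hν (b k)).lt_top).ne)
        hcont.aestronglyMeasurable ?_
      refine (ae_restrict_iff' measurableSet_Ioc).2 (Eventually.of_forall fun x hx => ?_)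
      rw [Real.norm_of_nonneg (Real.exp_pos _).le, Real.exp_le_exp]
      nlinarith [hx.1]

/-- At `x = 0` the exponential Chebyshev bound is just `C t`, and `t → ∞` is free. -/
lemma HeatBound.measure_singleton_zero {C : ℝ → ℝ} {ν : Measure ℝ} (h : HeatBound C ν)
    (hC : Tendsto C atTop (𝓝 0)) : ν {0} = 0 := by
  have h1 : Tendsto (fun t => ENNReal.ofReal (C t)) atTop (𝓝 0) := by
    simpa using ENNReal.tendsto_ofReal hC
  refine le_antisymm (ge_of_tendsto h1 ?_) (zero_le)
  filter_upwards [eventually_gt_atTop 0] with t ht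
  refine (measure_mono (by simp)).trans ((h.measure_Iic_le ht 0).trans ?_)
  simp

/-- Convergence of the integrals of exponentially decaying continuous functions. -/
lemma HeatBound.tendsto_integral {C : ℝ → ℝ} {κ : ℕ → Measure ℝ} {ν : Measure ℝ}
    [IsLocallyFiniteMeasure ν] (hκ : ∀ n, HeatBound C (κ n))
    (hlim : ∀ x, ν {x} = 0 → Tendsto (fun n => κ n (Iic x)) atTop (𝓝 (ν (Iic x))))
    {f : ℝ → ℝ} (hf : Continuous f) {t K : ℝ} (ht : 0 < t) (hK0 : 0 ≤ K)
    (hK : ∀ x, 0 ≤ x → |f x| ≤ K * Real.exp (-(t * x))) :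
    Tendsto (fun n => ∫ x, f x ∂κ n) atTop (𝓝 (∫ x, f x ∂ν)) := by
  have hν := HeatBound.of_tendsto hκ hlim
  obtain ⟨a, ha, -, ha0⟩ := exists_nonatom_between ν (show (-1 : ℝ) < 0 by norm_num)
  have htail : Tendsto (fun M : ℝ => K * Real.exp (-(t / 2 * M)) * C (t / 2)) atTop (𝓝 0) := by
    have h1 : Tendsto (fun M : ℝ => Real.exp (-(t / 2 * M))) atTop (𝓝 0) :=
      Real.tendsto_exp_neg_atTop_nhds_zero.comp
        (Tendsto.const_mul_atTop (half_pos ht) tendsto_id)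
    simpa using (h1.const_mul K).mul_const (C (t / 2))
  rw [Metric.tendsto_nhds]
  intro η hη
  obtain ⟨M₀, hM₀⟩ := eventually_atTop.1
    (htail.eventually (gt_mem_nhds (show 0 < η / 3 by positivity)))
  obtain ⟨M, hM, hM1, -⟩ := exists_nonatom_between ν (lt_add_one (max M₀ 0))
  have hMη := hM₀ M ((le_max_left _ _).trans hM1.le)
  have hMa : a ≤ M := ha0.le.trans ((le_max_right _ _).trans hM1.le)
  have hl := tendsto_setIntegral_Ioc (fun n => (hκ n).measure_Iic_ne_top) hν.measure_Iic_ne_top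
    hlim hf ha hM hMa
  filter_upwards [(Metric.tendsto_nhds.1 hl) (η / 3) (by positivity)] with n hn
  rw [Real.dist_eq] at hn ⊢
  have h1 := abs_le.1 ((hκ n).abs_integral_sub_setIntegral_le ht hK0 hf.measurable hK
    (M := M) ha0)
  have h2 := abs_le.1 (hν.abs_integral_sub_setIntegral_le ht hK0 hf.measurable hK (M := M) ha0)
  rw [abs_lt] at hn ⊢
  constructor <;> linarith [h1.1, h1.2, h2.1, h2.2, hn.1, hn.2]

/-! ### The Bose–Einstein factor -/

lemma boseFactor_nonneg {β μ x : ℝ} (hβ : 0 < β) (hx : μ < x) : 0 ≤ boseFactor β μ x := by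
  have : 1 < Real.exp (β * (x - μ)) := Real.one_lt_exp_iff.2 (mul_pos hβ (sub_pos.2 hx))
  exact div_nonneg zero_le_one (by linarith)

lemma boseFactor_mono {β μ μ' x : ℝ} (hβ : 0 < β) (h : μ ≤ μ') (hx : μ' < x) :
    boseFactor β μ x ≤ boseFactor β μ' x := by
  have : 1 < Real.exp (β * (x - μ')) := Real.one_lt_exp_iff.2 (mul_pos hβ (sub_pos.2 hx))
  unfold boseFactor
  gcongr

lemma one_div_exp_sub_one_le {a y : ℝ} (ha : 0 < a) (hy : a ≤ y) :
    1 / (Real.exp y - 1) ≤ Real.exp (-y) / (1 - Real.exp (-a)) := by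
  have h1 : 1 < Real.exp y := Real.one_lt_exp_iff.2 (ha.trans_le hy)
  have h2 : Real.exp (-a) < 1 := Real.exp_lt_one_iff.2 (by linarith)
  have h3 : Real.exp (-y) ≤ Real.exp (-a) := Real.exp_le_exp.2 (by linarith)
  have h4 : Real.exp (-y) * Real.exp y = 1 := by
    rw [← Real.exp_add]
    simp
  rw [div_le_div_iff₀ (by linarith) (by linarith)]
  nlinarith

/-- The constant in the exponential bound of the Bose–Einstein factor. -/
def boseConst (β μ : ℝ) : ℝ := Real.exp (β * μ) / (1 - Real.exp (β * μ))

lemma boseConst_nonneg {β μ : ℝ} (hβ : 0 < β) (hμ : μ < 0) : 0 ≤ boseConst β μ := by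
  have : Real.exp (β * μ) < 1 := Real.exp_lt_one_iff.2 (mul_neg_of_pos_of_neg hβ hμ)
  exact div_nonneg (Real.exp_pos _).le (by linarith)

lemma boseFactor_le {β μ x : ℝ} (hβ : 0 < β) (hμ : μ < 0) (hx : 0 ≤ x) :
    boseFactor β μ x ≤ boseConst β μ * Real.exp (-(β * x)) := by
  refine (one_div_exp_sub_one_le (a := -(β * μ)) ?_ ?_).trans_eq ?_
  · have := mul_neg_of_pos_of_neg hβ hμ
    linarith
  · have := mul_nonneg hβ.le hx
    linarith
  · rw [boseConst, neg_neg, div_mul_eq_mul_div, ← Real.exp_add]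
    congr 2
    ring

lemma abs_boseFactor_le {β μ x : ℝ} (hβ : 0 < β) (hμ : μ < 0) (hx : 0 ≤ x) :
    |boseFactor β μ x| ≤ boseConst β μ * Real.exp (-(β * x)) := by
  rw [abs_of_nonneg (boseFactor_nonneg hβ (hμ.trans_le hx))]
  exact boseFactor_le hβ hμ hx

lemma measurable_boseFactor (β μ : ℝ) : Measurable (boseFactor β μ) := by
  unfold boseFactor
  fun_prop

lemma continuous_boseFactor_max {β μ : ℝ} (hβ : 0 < β) (hμ : μ < 0) :
    Continuous fun x => boseFactor β μ (max x 0) := by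
  unfold boseFactor
  refine Continuous.div (by fun_prop) (by fun_prop) fun x => ?_
  have : 1 < Real.exp (β * (max x 0 - μ)) :=
    Real.one_lt_exp_iff.2 (mul_pos hβ (sub_pos.2 (hμ.trans_le (le_max_right _ _))))
  exact (sub_pos.2 this).ne'

lemma continuousAt_boseFactor {β μ x : ℝ} (hβ : 0 < β) (hx : μ < x) :
    ContinuousAt (fun μ' => boseFactor β μ' x) μ := by
  unfold boseFactor
  refine ContinuousAt.div (by fun_prop) (by fun_prop) ?_
  have : 1 < Real.exp (β * (x - μ)) := Real.one_lt_exp_iff.2 (mul_pos hβ (sub_pos.2 hx))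
  exact (sub_pos.2 this).ne'

/-- Away from the bottom of the spectrum the Bose–Einstein factor is uniformly continuous in the
chemical potential. -/
lemma boseFactor_sub_le {β δ s x : ℝ} (hβ : 0 < β) (hδ : 0 < δ) (hs : s < δ / 2)
    (hs0 : 0 < s) (hx : δ ≤ x) :
    boseFactor β s x - boseFactor β (-s) x
      ≤ (Real.exp (β * s) - Real.exp (-(β * s)))
        * (Real.exp (β * δ) / (1 - Real.exp (-(β * δ / 2))) ^ 2) * Real.exp (-(β * x)) := by
  have hc : 0 < 1 - Real.exp (-(β * δ / 2)) := by
    have : Real.exp (-(β * δ / 2)) < 1 := Real.exp_lt_one_iff.2 (by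
      have := mul_pos hβ hδ
      linarith)
    linarith
  have hβx : β * δ ≤ β * x := mul_le_mul_of_nonneg_left hx hβ.le
  have hβs : β * s < β * (δ / 2) := mul_lt_mul_of_pos_left hs hβ
  have hβs0 : 0 < β * s := mul_pos hβ hs0
  -- Both denominators, with `r = ±βs`, are bounded below at once; `1` is absorbed through `1 ≤ exp
  -- (βx - βδ)`, valid since `δ ≤ x`.
  have hlow : ∀ r, -(β * δ / 2) ≤ r →
      Real.exp (β * x + r) - 1 ≥ Real.exp (β * x - β * δ / 2) * (1 - Real.exp (-(β * δ / 2))) := by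
    intro r hr
    have h1 : Real.exp (β * x - β * δ / 2) ≤ Real.exp (β * x + r) :=
      Real.exp_le_exp.2 (by linarith)
    have h2 : 1 ≤ Real.exp (β * x - β * δ / 2) * Real.exp (-(β * δ / 2)) := by
      rw [← Real.exp_add]
      exact Real.one_le_exp (by linarith)
    linarith
  have h1 := hlow (-(β * s)) (by linarith)
  have h2 := hlow (β * s) (by linarith)
  have hA : 0 < Real.exp (β * x - β * δ / 2) * (1 - Real.exp (-(β * δ / 2))) := by positivity
  have e1 : β * (x - s) = β * x + -(β * s) := by ring
  have e2 : β * (x - -s) = β * x + β * s := by ring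
  have hpos : 0 ≤ Real.exp (β * s) - Real.exp (-(β * s)) :=
    sub_nonneg.2 (Real.exp_le_exp.2 (by linarith))
  unfold boseFactor
  rw [e1, e2, div_sub_div _ _ (by linarith) (by linarith), one_mul, mul_one]
  calc (Real.exp (β * x + β * s) - 1 - (Real.exp (β * x + -(β * s)) - 1))
        / ((Real.exp (β * x + -(β * s)) - 1) * (Real.exp (β * x + β * s) - 1))
      ≤ (Real.exp (β * x) * (Real.exp (β * s) - Real.exp (-(β * s))))
        / ((Real.exp (β * x - β * δ / 2) * (1 - Real.exp (-(β * δ / 2))))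
          * (Real.exp (β * x - β * δ / 2) * (1 - Real.exp (-(β * δ / 2))))) := by
        have e3 : Real.exp (β * x + β * s) - 1 - (Real.exp (β * x + -(β * s)) - 1)
            = Real.exp (β * x) * (Real.exp (β * s) - Real.exp (-(β * s))) := by
          rw [Real.exp_add, Real.exp_add]
          ring
        rw [e3]
        have h3 := hA.le.trans h1
        gcongr
    _ = _ := by
        have e4 : Real.exp (β * x - β * δ / 2) * Real.exp (β * x - β * δ / 2)
            * Real.exp (-(β * x)) * Real.exp (β * δ) = Real.exp (β * x) := by
          rw [← Real.exp_add, ← Real.exp_add, ← Real.exp_add]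
          congr 1
          ring
        have e5 : Real.exp (β * x - β * δ / 2) ≠ 0 := (Real.exp_pos _).ne'
        rw [← e4]
        field_simp

/-! ### The thermodynamic limit of the occupation measures -/

/-- For ordered functions the `L¹` distance equals the difference of the integrals. Controlling
total masses therefore suffices, and convergence of the chemical potentials never has to be shown.
-/
lemma abs_integral_mul_sub_le {κ : Measure ℝ} {g w u : ℝ → ℝ} {B : ℝ}
    (hB : ∀ x, |g x| ≤ B) (hw : Integrable w κ) (hu : Integrable u κ)
    (h : (∀ᵐ x ∂κ, u x ≤ w x) ∨ (∀ᵐ x ∂κ, w x ≤ u x)) :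
    |∫ x, g x * (w x - u x) ∂κ| ≤ B * |∫ x, w x ∂κ - ∫ x, u x ∂κ| := by
  have h1 : |∫ x, g x * (w x - u x) ∂κ| ≤ B * ∫ x, |w x - u x| ∂κ := by
    rw [← integral_const_mul, ← Real.norm_eq_abs]
    refine norm_integral_le_of_norm_le ((hw.sub hu).abs.const_mul B)
      (Eventually.of_forall fun x => ?_)
    rw [norm_mul, Real.norm_eq_abs, Real.norm_eq_abs]
    exact mul_le_mul_of_nonneg_right (hB x) (abs_nonneg _)
  have hB0 : 0 ≤ B := (abs_nonneg _).trans (hB 0)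
  refine h1.trans (mul_le_mul_of_nonneg_left ?_ hB0)
  rw [← integral_sub hw hu]
  rcases h with h | h
  · rw [integral_congr_ae (g := fun x => w x - u x)]
    · exact le_abs_self _
    · filter_upwards [h] with x hx
      exact abs_of_nonneg (sub_nonneg.2 hx)
  · rw [integral_congr_ae (g := fun x => -(w x - u x)), integral_neg]
    · exact neg_le_abs _
    · filter_upwards [h] with x hx
      exact abs_of_nonpos (sub_nonpos.2 hx)

namespace HeatBound

variable {C : ℝ → ℝ} {β : ℝ}

lemma integrable_boseFactor {κ : Measure ℝ} (h : HeatBound C κ) (hβ : 0 < β) {μ : ℝ}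
    (hμ : μ < 0) : Integrable (boseFactor β μ) κ :=
  h.integrable_of_bound hβ (measurable_boseFactor β μ).aestronglyMeasurable
    fun _ hx => abs_boseFactor_le hβ hμ hx

lemma integral_boseFactor_nonneg {κ : Measure ℝ} (h : HeatBound C κ) (hβ : 0 < β) {μ : ℝ}
    (hμ : μ < 0) : 0 ≤ ∫ x, boseFactor β μ x ∂κ := by
  refine integral_nonneg_of_ae ?_
  filter_upwards [h.ae_nonneg] with x hx
  exact boseFactor_nonneg hβ (hμ.trans_le hx)

lemma tendsto_integral_mul_boseFactor {κ : ℕ → Measure ℝ} {ν : Measure ℝ}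
    [IsLocallyFiniteMeasure ν] (hκ : ∀ n, HeatBound C (κ n))
    (hlim : ∀ x, ν {x} = 0 → Tendsto (fun n => κ n (Iic x)) atTop (𝓝 (ν (Iic x))))
    (hβ : 0 < β) {μ : ℝ} (hμ : μ < 0) {f : ℝ → ℝ} (hf : Continuous f) {B : ℝ}
    (hB : ∀ x, |f x| ≤ B) :
    Tendsto (fun n => ∫ x, f x * boseFactor β μ x ∂κ n) atTop
      (𝓝 (∫ x, f x * boseFactor β μ x ∂ν)) := by
  have hB0 : 0 ≤ B := (abs_nonneg _).trans (hB 0)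
  -- The Bose factor has a pole at `μ < 0`. Since the measures live on `[0, ∞)`, it may be replaced
  -- by a function continuous on all of `ℝ`.
  have heq : ∀ m : Measure ℝ, HeatBound C m →
      ∫ x, f x * boseFactor β μ x ∂m = ∫ x, f x * boseFactor β μ (max x 0) ∂m := by
    intro m hm
    refine integral_congr_ae ?_
    filter_upwards [hm.ae_nonneg] with x hx
    rw [max_eq_left hx]
  simp_rw [heq ν (of_tendsto hκ hlim), fun n => heq (κ n) (hκ n)]
  refine tendsto_integral hκ hlim (hf.mul (continuous_boseFactor_max hβ hμ)) hβ
    (K := B * boseConst β μ) (mul_nonneg hB0 (boseConst_nonneg hβ hμ)) fun x hx => ?_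
  rw [abs_mul, max_eq_left hx, mul_assoc]
  exact mul_le_mul (hB x) (abs_boseFactor_le hβ hμ hx) (abs_nonneg _) hB0

lemma tendsto_integral_boseFactor {κ : ℕ → Measure ℝ} {ν : Measure ℝ}
    [IsLocallyFiniteMeasure ν] (hκ : ∀ n, HeatBound C (κ n))
    (hlim : ∀ x, ν {x} = 0 → Tendsto (fun n => κ n (Iic x)) atTop (𝓝 (ν (Iic x))))
    (hβ : 0 < β) {μ : ℝ} (hμ : μ < 0) :
    Tendsto (fun n => ∫ x, boseFactor β μ x ∂κ n) atTop (𝓝 (∫ x, boseFactor β μ x ∂ν)) := by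
  simpa using tendsto_integral_mul_boseFactor hκ hlim hβ hμ (f := fun _ => 1)
    continuous_const (B := 1) (by simp)

/-- The two Bose–Einstein factors are ordered. -/
lemma boseFactor_ae_le_or {κ : Measure ℝ} (h : HeatBound C κ) (hβ : 0 < β) {μ μ' : ℝ}
    (hμ : μ < 0) (hμ' : ∀ᵐ x ∂κ, μ' < x) :
    (∀ᵐ x ∂κ, boseFactor β μ x ≤ boseFactor β μ' x) ∨
      (∀ᵐ x ∂κ, boseFactor β μ' x ≤ boseFactor β μ x) := by
  rcases le_total μ μ' with hle | hle
  · left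
    filter_upwards [hμ'] with x hx
    exact boseFactor_mono hβ hle hx
  · right
    filter_upwards [h.ae_nonneg] with x hx
    exact boseFactor_mono hβ hle (hμ.trans_le hx)

/-- Below the critical density the limit is absolutely continuous with respect to `ν`. -/
theorem tendsto_of_subcritical {κ : ℕ → Measure ℝ} {ν : Measure ℝ}
    [IsLocallyFiniteMeasure ν] (hκ : ∀ n, HeatBound C (κ n))
    (hlim : ∀ x, ν {x} = 0 → Tendsto (fun n => κ n (Iic x)) atTop (𝓝 (ν (Iic x))))
    (hβ : 0 < β) {ρ : ℝ} {μ : ℕ → ℝ} (hμ : ∀ n, ∀ᵐ x ∂κ n, μ n < x)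
    (hint : ∀ n, Integrable (boseFactor β (μ n)) (κ n))
    (hρ : ∀ n, ∫ x, boseFactor β (μ n) x ∂κ n = ρ) {μ₀ : ℝ} (hμ₀ : μ₀ < 0)
    (hρ₀ : ∫ x, boseFactor β μ₀ x ∂ν = ρ) {f : ℝ → ℝ} (hf : Continuous f) {B : ℝ}
    (hB : ∀ x, |f x| ≤ B) :
    Tendsto (fun n => ∫ x, f x * boseFactor β (μ n) x ∂κ n) atTop
      (𝓝 (∫ x, f x * boseFactor β μ₀ x ∂ν)) := by
  have h1 := tendsto_integral_mul_boseFactor hκ hlim hβ hμ₀ hf hB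
  have h2 : Tendsto (fun n => B * |ρ - ∫ x, boseFactor β μ₀ x ∂κ n|) atTop (𝓝 0) := by
    have := ((tendsto_integral_boseFactor hκ hlim hβ hμ₀).const_sub ρ).abs.const_mul B
    simpa [hρ₀] using this
  -- Under `κ n` the factor at `μ n` has mass exactly `ρ` and the factor at `μ₀` has mass tending to
  -- `ρ`.
  have h3 : Tendsto (fun n => ∫ x, f x * boseFactor β (μ n) x ∂κ n
      - ∫ x, f x * boseFactor β μ₀ x ∂κ n) atTop (𝓝 0) := by
    refine squeeze_zero_norm (fun n => ?_) h2
    have hi₀ := (hκ n).integrable_boseFactor hβ hμ₀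
    have hbd : ∀ᵐ x ∂κ n, ‖f x‖ ≤ B := Eventually.of_forall hB
    rw [← integral_sub ((hint n).bdd_mul hf.aestronglyMeasurable hbd)
      (hi₀.bdd_mul hf.aestronglyMeasurable hbd), Real.norm_eq_abs]
    simp_rw [← mul_sub]
    rw [← hρ n]
    exact abs_integral_mul_sub_le hB (hint n) hi₀
      ((hκ n).boseFactor_ae_le_or hβ hμ₀ (hμ n))
  simpa using h3.add h1

/-- At and above the critical density the excess mass condenses at zero energy. -/
theorem tendsto_of_supercritical {κ : ℕ → Measure ℝ} {ν : Measure ℝ}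
    [IsLocallyFiniteMeasure ν] (hκ : ∀ n, HeatBound C (κ n))
    (hlim : ∀ x, ν {x} = 0 → Tendsto (fun n => κ n (Iic x)) atTop (𝓝 (ν (Iic x))))
    (hβ : 0 < β) {ρ : ℝ} (hρ0 : 0 ≤ ρ) {μ : ℕ → ℝ} (hμ : ∀ n, ∀ᵐ x ∂κ n, μ n < x)
    (hμ0 : ∀ s, 0 < s → ∀ᶠ n in atTop, μ n < s)
    (hint : ∀ n, Integrable (boseFactor β (μ n)) (κ n))
    (hρ : ∀ n, ∫ x, boseFactor β (μ n) x ∂κ n = ρ)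
    (hρc : ∀ μ₀ < 0, ∫ x, boseFactor β μ₀ x ∂ν ≤ ρ) {f : ℝ → ℝ} (hf : Continuous f) {B : ℝ}
    (hB : ∀ x, |f x| ≤ B) {L : ℝ}
    (hL : Tendsto (fun s => ∫ x, f x * boseFactor β (-s) x ∂ν
      + f 0 * (ρ - ∫ x, boseFactor β (-s) x ∂ν)) (𝓝[>] 0) (𝓝 L)) :
    Tendsto (fun n => ∫ x, f x * boseFactor β (μ n) x ∂κ n) atTop (𝓝 L) := by
  have hB0 : 0 ≤ B := (abs_nonneg _).trans (hB 0)
  have hCβ : 0 ≤ C β := (hκ 0).const_nonneg β hβ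
  rw [Metric.tendsto_nhds]
  intro η hη
  set ε := η / (4 * (ρ + 1)) with hε_def
  have hε : 0 < ε := by positivity
  obtain ⟨δ, hδ, hfδ⟩ := Metric.continuousAt_iff.1 (hf.continuousAt (x := 0)) ε hε
  set K := Real.exp (β * δ) / (1 - Real.exp (-(β * δ / 2))) ^ 2 with hK_def
  have hK0 : 0 ≤ K := by positivity
  have hD : Tendsto (fun s => 2 * B * ((Real.exp (β * s) - Real.exp (-(β * s))) * K) * C β)
      (𝓝[>] 0) (𝓝 0) := by
    have hc : Continuous fun s => 2 * B * ((Real.exp (β * s) - Real.exp (-(β * s))) * K) * C β := by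
      fun_prop
    have := (hc.tendsto 0).mono_left (nhdsWithin_le_nhds (s := Ioi 0))
    simpa using this
  -- The parameter `s` is fixed before `n`. The final error is at most `η/4 + η/4 + 3η/8 < η`.
  obtain ⟨s, hsL, hsD, hsδ, hs0⟩ := ((Metric.tendsto_nhds.1 hL (η / 4) (by positivity)).and
    ((hD.eventually (gt_mem_nhds (show 0 < η / 8 by positivity))).and
    ((eventually_nhdsWithin_of_eventually_nhds (eventually_lt_nhds (half_pos hδ))).and
      self_mem_nhdsWithin))).exists
  have hs0 : 0 < s := hs0
  have hμ₀ : -s < 0 := by linarith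
  set D := (Real.exp (β * s) - Real.exp (-(β * s))) * K with hD_def
  have hD0 : 0 ≤ D := by
    refine mul_nonneg (sub_nonneg.2 (Real.exp_le_exp.2 ?_)) hK0
    have := mul_pos hβ hs0
    linarith
  have hT : Tendsto (fun n => ∫ x, f x * boseFactor β (-s) x ∂κ n
      + f 0 * (ρ - ∫ x, boseFactor β (-s) x ∂κ n)) atTop
      (𝓝 (∫ x, f x * boseFactor β (-s) x ∂ν + f 0 * (ρ - ∫ x, boseFactor β (-s) x ∂ν))) :=
    (tendsto_integral_mul_boseFactor hκ hlim hβ hμ₀ hf hB).add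
      (((tendsto_integral_boseFactor hκ hlim hβ hμ₀).const_sub ρ).const_mul (f 0))
  have hF := (tendsto_integral_boseFactor hκ hlim hβ hμ₀).eventually
    (gt_mem_nhds (show ∫ x, boseFactor β (-s) x ∂ν < ρ + η / (8 * (B + 1)) by
      have := hρc (-s) hμ₀
      have : 0 < η / (8 * (B + 1)) := by positivity
      linarith))
  filter_upwards [Metric.tendsto_nhds.1 hT (η / 4) (by positivity), hF, hμ0 s hs0]
    with n hn hFn hμn
  have hi₀ := (hκ n).integrable_boseFactor hβ hμ₀
  have hbd : ∀ᵐ x ∂κ n, ‖f x‖ ≤ B := Eventually.of_forall hB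
  have hfw := (hint n).bdd_mul hf.aestronglyMeasurable hbd
  have hfu := hi₀.bdd_mul hf.aestronglyMeasurable hbd
  have hsub : Integrable (fun x => boseFactor β (μ n) x - boseFactor β (-s) x) (κ n) :=
    (hint n).sub hi₀
  have hfsub : Integrable (fun x => f x * boseFactor β (μ n) x - f x * boseFactor β (-s) x)
      (κ n) := hfw.sub hfu
  have hdiff : ∀ x, |f x - f 0| ≤ 2 * B := by
    intro x
    have h1 := abs_le.1 (hB x)
    have h2 := abs_le.1 (hB 0)
    rw [abs_le]
    constructor <;> linarith [h1.1, h1.2, h2.1, h2.2]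
  have hsplit : ∫ x, (f x - f 0) * (boseFactor β (μ n) x - boseFactor β (-s) x) ∂κ n
      = ∫ x, f x * boseFactor β (μ n) x ∂κ n - (∫ x, f x * boseFactor β (-s) x ∂κ n
        + f 0 * (ρ - ∫ x, boseFactor β (-s) x ∂κ n)) := by
    have e1 : ∫ x, (f x - f 0) * (boseFactor β (μ n) x - boseFactor β (-s) x) ∂κ n
        = ∫ x, ((f x * boseFactor β (μ n) x - f x * boseFactor β (-s) x)
          - f 0 * (boseFactor β (μ n) x - boseFactor β (-s) x)) ∂κ n := by
      congr 1
      ext x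
      ring
    rw [e1, integral_sub hfsub (hsub.const_mul _), integral_sub hfw hfu,
      integral_const_mul, integral_sub (hint n) hi₀, hρ n]
    ring
  have hmain : |∫ x, (f x - f 0) * (boseFactor β (μ n) x - boseFactor β (-s) x) ∂κ n|
      ≤ 3 * η / 8 := by
    -- If `-s ≤ μ n < s`, then `f` is close to `f 0` on energies below `δ`, and above `δ` the two
    -- Bose factors nearly agree; `μ n` may be positive. If `μ n ≤ -s`, the mass of the factor at
    -- `-s` lies between `ρ` and slightly more than `ρ`, so the factors are close in `L¹`.
    rcases le_total (-s) (μ n) with hle | hle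
    · have hpt : ∀ᵐ x ∂κ n, |(f x - f 0) * (boseFactor β (μ n) x - boseFactor β (-s) x)|
          ≤ ε * (boseFactor β (μ n) x - boseFactor β (-s) x)
            + 2 * B * (D * Real.exp (-(β * x))) := by
        filter_upwards [(hκ n).ae_nonneg, hμ n] with x hx0 hx
        have hw : 0 ≤ boseFactor β (μ n) x - boseFactor β (-s) x :=
          sub_nonneg.2 (boseFactor_mono hβ hle hx)
        rw [abs_mul, abs_of_nonneg hw]
        by_cases hxδ : x < δ
        · have h1 : |f x - f 0| ≤ ε := by
            have := hfδ (x := x) (by simpa [abs_of_nonneg hx0] using hxδ)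
            exact this.le
          have h2 : 0 ≤ 2 * B * (D * Real.exp (-(β * x))) := by positivity
          have h3 := mul_le_mul_of_nonneg_right h1 hw
          linarith
        · rw [not_lt] at hxδ
          have hsx : s < x := by linarith
          have h1 : boseFactor β (μ n) x - boseFactor β (-s) x ≤ D * Real.exp (-(β * x)) :=
            (sub_le_sub_right (boseFactor_mono hβ hμn.le hsx) _).trans
              (boseFactor_sub_le hβ hδ hsδ hs0 hxδ)
          have h2 := mul_le_mul (hdiff x) h1 hw (by linarith)
          have h3 := mul_nonneg hε.le hw
          linarith
      have hexp := (hκ n).integrable_exp hβ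
      have h1 : |∫ x, (f x - f 0) * (boseFactor β (μ n) x - boseFactor β (-s) x) ∂κ n|
          ≤ ∫ x, (ε * (boseFactor β (μ n) x - boseFactor β (-s) x)
            + 2 * B * (D * Real.exp (-(β * x)))) ∂κ n := by
        rw [← Real.norm_eq_abs]
        exact norm_integral_le_of_norm_le ((hsub.const_mul ε).add
          ((hexp.const_mul D).const_mul (2 * B))) hpt
      rw [integral_add (hsub.const_mul ε) ((hexp.const_mul D).const_mul (2 * B)),
        integral_const_mul, integral_const_mul, integral_const_mul, integral_sub (hint n) hi₀,
        hρ n] at h1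
      have h2 := (hκ n).integral_boseFactor_nonneg hβ hμ₀
      have h3 : 2 * B * (D * ∫ x, Real.exp (-(β * x)) ∂κ n) ≤ 2 * B * D * C β := by
        rw [← mul_assoc]
        exact mul_le_mul_of_nonneg_left ((hκ n).integral_exp_le hβ) (by positivity)
      have h4 : ε * ρ ≤ η / 4 := by
        rw [hε_def, div_mul_eq_mul_div, div_le_div_iff₀ (by positivity) (by norm_num)]
        nlinarith
      have h5 := mul_nonneg hε.le h2
      linarith
    · have h1 := abs_integral_mul_sub_le (g := fun x => f x - f 0) (B := 2 * B)
        hdiff (hint n) hi₀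
        ((hκ n).boseFactor_ae_le_or hβ hμ₀ (hμ n))
      refine h1.trans ?_
      have h2 : ρ ≤ ∫ x, boseFactor β (-s) x ∂κ n := by
        rw [← hρ n]
        refine integral_mono_ae (hint n) hi₀ ?_
        filter_upwards [(hκ n).ae_nonneg] with x hx
        exact boseFactor_mono hβ hle (hμ₀.trans_le hx)
      rw [hρ n, abs_of_nonpos (by linarith)]
      have h3 : 2 * B * -(ρ - ∫ x, boseFactor β (-s) x ∂κ n)
          ≤ 2 * B * (η / (8 * (B + 1))) :=
        mul_le_mul_of_nonneg_left (by linarith) (by positivity)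
      have h4 : 2 * B * (η / (8 * (B + 1))) ≤ η / 4 := by
        rw [← mul_div_assoc, div_le_div_iff₀ (by positivity) (by norm_num)]
        nlinarith
      linarith
  rw [hsplit] at hmain
  rw [Real.dist_eq] at hn hsL ⊢
  have a1 := abs_le.1 hmain
  have a2 := abs_lt.1 hn
  have a3 := abs_lt.1 hsL
  rw [abs_lt]
  constructor <;> linarith [a1.1, a1.2, a2.1, a2.2, a3.1, a3.2]

end HeatBound

/-! ### The limiting occupation measure -/

lemma lintegral_mul_boseFactor {κ : Measure ℝ} {β μ : ℝ} (hβ : 0 < β)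
    (hμ : ∀ᵐ x ∂κ, μ < x) (hint : Integrable (boseFactor β μ) κ) {f : ℝ → ℝ≥0}
    (hf : Continuous f) {B : ℝ≥0} (hB : ∀ x, f x ≤ B) :
    ∫⁻ x, f x * ENNReal.ofReal (boseFactor β μ x) ∂κ
      = ENNReal.ofReal (∫ x, f x * boseFactor β μ x ∂κ) := by
  rw [ofReal_integral_eq_lintegral_ofReal]
  · refine lintegral_congr fun x => ?_
    rw [ENNReal.ofReal_mul (f x).coe_nonneg, ENNReal.ofReal_coe_nnreal]
  · refine hint.bdd_mul (c := B) (by fun_prop) (Eventually.of_forall fun x => ?_)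
    simpa using hB x
  · filter_upwards [hμ] with x hx
    exact mul_nonneg (f x).coe_nonneg (boseFactor_nonneg hβ hx)

namespace HeatBound

variable {C : ℝ → ℝ} {β : ℝ} {ν : Measure ℝ}

lemma ae_pos (h : HeatBound C ν) (h0 : ν {0} = 0) : ∀ᵐ x ∂ν, 0 < x := by
  have h1 : ∀ᵐ x ∂ν, x ≠ 0 := by simpa [ae_iff] using h0
  filter_upwards [h.ae_nonneg, h1] with x hx hx0
  exact lt_of_le_of_ne hx hx0.symm

lemma criticalDensity_eq (h : HeatBound C ν) (hβ : 0 < β) :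
    criticalDensity β ν
      = ⨆ (μ : ℝ) (_ : μ < 0), ENNReal.ofReal (∫ x, boseFactor β μ x ∂ν) := by
  unfold criticalDensity
  refine iSup_congr fun μ => iSup_congr fun hμ => ?_
  rw [Measure.restrict_eq_self_of_ae_mem (show ∀ᵐ x ∂ν, x ∈ Ici (0 : ℝ) from h.ae_nonneg),
    ofReal_integral_eq_lintegral_ofReal (h.integrable_boseFactor hβ hμ)]
  · rfl
  · filter_upwards [h.ae_nonneg] with x hx
    exact boseFactor_nonneg hβ (hμ.trans_le hx)

lemma continuousOn_integral_boseFactor (h : HeatBound C ν) (hβ : 0 < β) :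
    ContinuousOn (fun μ => ∫ x, boseFactor β μ x ∂ν) (Iio 0) := by
  intro μ hμ
  have hμ : μ < 0 := hμ
  refine ContinuousAt.continuousWithinAt ?_
  have hμ2 : μ / 2 < 0 := by linarith
  refine continuousAt_of_dominated (bound := boseFactor β (μ / 2))
    (Eventually.of_forall fun μ' => (measurable_boseFactor β μ').aestronglyMeasurable) ?_
    (h.integrable_boseFactor hβ hμ2) ?_
  · filter_upwards [eventually_lt_nhds (show μ < μ / 2 by linarith)] with μ' hμ'
    filter_upwards [h.ae_nonneg] with x hx
    rw [Real.norm_of_nonneg (boseFactor_nonneg hβ (by linarith))]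
    exact boseFactor_mono hβ hμ'.le (by linarith)
  · filter_upwards [h.ae_nonneg] with x hx
    exact continuousAt_boseFactor hβ (hμ.trans_le hx)

/-- Intermediate value theorem: the mass exceeds `ρ` at some `μ₁ < 0` by definition of the supremum
and tends to `0` as `μ → -∞` by the exponential bound. -/
lemma exists_integral_boseFactor_eq (h : HeatBound C ν) (hβ : 0 < β) {ρ : ℝ} (hρ : 0 < ρ)
    (hc : ENNReal.ofReal ρ < criticalDensity β ν) :
    ∃ μ < 0, ∫ x, boseFactor β μ x ∂ν = ρ := by
  rw [h.criticalDensity_eq hβ] at hc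
  obtain ⟨μ₁, hc⟩ := lt_iSup_iff.1 hc
  obtain ⟨hμ₁, hc⟩ := lt_iSup_iff.1 hc
  have hc := (ENNReal.ofReal_lt_ofReal_iff_of_nonneg hρ.le).1 hc
  have hlim : Tendsto (fun μ => boseConst β μ * C β) atBot (𝓝 0) := by
    have h1 : Tendsto (fun μ => Real.exp (β * μ)) atBot (𝓝 0) :=
      Real.tendsto_exp_atBot.comp (tendsto_id.const_mul_atBot hβ)
    simpa [boseConst] using (h1.div (h1.const_sub 1) (by simp)).mul_const (C β)
  obtain ⟨μ₂, h₂, hμ₂⟩ := ((hlim.eventually (gt_mem_nhds hρ)).and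
    (eventually_le_atBot μ₁)).exists
  have hμ₂' : μ₂ < 0 := hμ₂.trans_lt hμ₁
  have hle : ∫ x, boseFactor β μ₂ x ∂ν ≤ ρ :=
    (le_abs_self _).trans ((h.abs_integral_le hβ (boseConst_nonneg hβ hμ₂')
      fun x hx => abs_boseFactor_le hβ hμ₂' hx).trans h₂.le)
  obtain ⟨μ, hμ, hμρ⟩ := intermediate_value_Icc hμ₂
    ((h.continuousOn_integral_boseFactor hβ).mono fun x hx => hx.2.trans_lt hμ₁) ⟨hle, hc.le⟩
  exact ⟨μ, hμ.2.trans_lt hμ₁, hμρ⟩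

/-- The critical density is the integral of the Bose–Einstein factor at `μ = 0`. -/
lemma lintegral_boseFactor_zero (h : HeatBound C ν) (h0 : ν {0} = 0) (hβ : 0 < β) :
    ∫⁻ x, ENNReal.ofReal (boseFactor β 0 x) ∂ν = criticalDensity β ν := by
  have heq : ∀ μ < 0, ENNReal.ofReal (∫ x, boseFactor β μ x ∂ν)
      = ∫⁻ x, ENNReal.ofReal (boseFactor β μ x) ∂ν := by
    intro μ hμ
    refine ofReal_integral_eq_lintegral_ofReal (h.integrable_boseFactor hβ hμ) ?_
    filter_upwards [h.ae_nonneg] with x hx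
    exact boseFactor_nonneg hβ (hμ.trans_le hx)
  rw [h.criticalDensity_eq hβ]
  apply le_antisymm
  · have hneg : ∀ k : ℕ, -(1 / ((k : ℝ) + 1)) < 0 := by
      intro k
      have : 0 < 1 / ((k : ℝ) + 1) := by positivity
      linarith
    have hlim : Tendsto (fun k : ℕ => -(1 / ((k : ℝ) + 1))) atTop (𝓝 0) := by
      simpa using (tendsto_one_div_add_atTop_nhds_zero_nat (𝕜 := ℝ)).neg
    calc ∫⁻ x, ENNReal.ofReal (boseFactor β 0 x) ∂ν
        = ∫⁻ x, liminf (fun k : ℕ =>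
            ENNReal.ofReal (boseFactor β (-(1 / ((k : ℝ) + 1))) x)) atTop ∂ν := by
          refine lintegral_congr_ae ?_
          -- The factor is continuous in the chemical potential at `0` only for `x > 0`; at `x = 0`
          -- division by zero gives the value `0`. Absence of an atom of `ν` at `0` makes this
          -- harmless.
          filter_upwards [h.ae_pos h0] with x hx
          exact (ENNReal.tendsto_ofReal
            ((continuousAt_boseFactor hβ hx).tendsto.comp hlim)).liminf_eq.symm
      _ ≤ liminf (fun k : ℕ =>
            ∫⁻ x, ENNReal.ofReal (boseFactor β (-(1 / ((k : ℝ) + 1))) x) ∂ν) atTop :=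
          lintegral_liminf_le fun k => (measurable_boseFactor _ _).ennreal_ofReal
      _ ≤ _ := by
          refine liminf_le_of_le (by isBoundedDefault) fun b hb => ?_
          obtain ⟨k, hk⟩ := hb.exists
          refine hk.trans ?_
          rw [← heq _ (hneg k)]
          exact le_iSup₂ (f := fun (μ : ℝ) (_ : μ < 0) =>
            ENNReal.ofReal (∫ x, boseFactor β μ x ∂ν)) _ (hneg k)
  · refine iSup₂_le fun μ hμ => ?_
    rw [heq μ hμ]
    refine lintegral_mono_ae ?_
    filter_upwards [h.ae_pos h0] with x hx
    exact ENNReal.ofReal_le_ofReal (boseFactor_mono hβ hμ.le hx)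

/-- The limit of the occupation measures exists and depends only on `β`, `ρ` and `ν`. -/
theorem exists_limit [IsLocallyFiniteMeasure ν] (h : HeatBound C ν) (h0 : ν {0} = 0)
    (hβ : 0 < β) {ρ : ℝ} (hρ : 0 < ρ) :
    ∃ m : Measure ℝ,
      m {0} = (if criticalDensity β ν ≤ ENNReal.ofReal ρ
        then ENNReal.ofReal ρ - criticalDensity β ν else 0) ∧
      ∀ (κ : ℕ → Measure ℝ) (μ : ℕ → ℝ), (∀ n, HeatBound C (κ n)) →
        (∀ x, ν {x} = 0 → Tendsto (fun n => κ n (Iic x)) atTop (𝓝 (ν (Iic x)))) →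
        (∀ n, ∀ᵐ x ∂κ n, μ n < x) → (∀ s, 0 < s → ∀ᶠ n in atTop, μ n < s) →
        (∀ n, ∫⁻ x, ENNReal.ofReal (boseFactor β (μ n) x) ∂κ n = ENNReal.ofReal ρ) →
        ∀ f : ℝ → ℝ≥0, Continuous f → (∃ B, ∀ x, f x ≤ B) →
          Tendsto (fun n => ∫⁻ x, f x * ENNReal.ofReal (boseFactor β (μ n) x) ∂κ n) atTop
            (𝓝 (∫⁻ x, f x ∂m)) := by
  have hfin : ∀ (κ : ℕ → Measure ℝ) (μ : ℕ → ℝ), (∀ n, ∀ᵐ x ∂κ n, μ n < x) →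
      (∀ n, ∫⁻ x, ENNReal.ofReal (boseFactor β (μ n) x) ∂κ n = ENNReal.ofReal ρ) →
      (∀ n, Integrable (boseFactor β (μ n)) (κ n)) ∧
      (∀ n, ∫ x, boseFactor β (μ n) x ∂κ n = ρ) := by
    intro κ μ hμ hs
    have hnn : ∀ n, 0 ≤ᵐ[κ n] boseFactor β (μ n) := fun n => by
      filter_upwards [hμ n] with x hx
      exact boseFactor_nonneg hβ hx
    have hi : ∀ n, Integrable (boseFactor β (μ n)) (κ n) := fun n => by
      refine ⟨(measurable_boseFactor _ _).aestronglyMeasurable, ?_⟩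
      rw [hasFiniteIntegral_iff_ofReal (hnn n), hs n]
      exact ENNReal.ofReal_lt_top
    refine ⟨hi, fun n => ?_⟩
    rw [integral_eq_lintegral_of_nonneg_ae (hnn n)
      (measurable_boseFactor _ _).aestronglyMeasurable, hs n, ENNReal.toReal_ofReal hρ.le]
  have hmeas : ∀ μ, Measurable fun x => ENNReal.ofReal (boseFactor β μ x) := fun μ =>
    (measurable_boseFactor β μ).ennreal_ofReal
  have hden : ∀ μ (f : ℝ → ℝ≥0), Continuous f →
      ∫⁻ x, f x ∂(ν.withDensity fun x => ENNReal.ofReal (boseFactor β μ x))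
        = ∫⁻ x, f x * ENNReal.ofReal (boseFactor β μ x) ∂ν := by
    intro μ f hf
    rw [lintegral_withDensity_eq_lintegral_mul _ (hmeas μ) (by fun_prop)]
    refine lintegral_congr fun x => ?_
    rw [Pi.mul_apply, mul_comm]
  have hatom : ∀ μ, (ν.withDensity fun x => ENNReal.ofReal (boseFactor β μ x)) {0} = 0 := fun μ =>
    withDensity_absolutelyContinuous ν _ h0
  by_cases hc : criticalDensity β ν ≤ ENNReal.ofReal ρ
  · have hz := h.lintegral_boseFactor_zero h0 hβ
    have hpos := h.ae_pos h0
    have hnn : 0 ≤ᵐ[ν] boseFactor β 0 := by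
      filter_upwards [hpos] with x hx
      exact boseFactor_nonneg hβ hx
    have hi : Integrable (boseFactor β 0) ν := by
      refine ⟨(measurable_boseFactor _ _).aestronglyMeasurable, ?_⟩
      rw [hasFiniteIntegral_iff_ofReal hnn, hz]
      exact hc.trans_lt ENNReal.ofReal_lt_top
    have hz' : ENNReal.ofReal (∫ x, boseFactor β 0 x ∂ν) = criticalDensity β ν := by
      rw [ofReal_integral_eq_lintegral_ofReal hi hnn, hz]
    have hle : ∫ x, boseFactor β 0 x ∂ν ≤ ρ := by
      rwa [← ENNReal.ofReal_le_ofReal_iff hρ.le, hz']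
    -- The saturated Bose distribution accounts for `ρ_c`; the surplus is the condensate at zero
    -- energy.
    refine ⟨ν.withDensity (fun x => ENNReal.ofReal (boseFactor β 0 x))
      + (ENNReal.ofReal ρ - criticalDensity β ν) • Measure.dirac 0, ?_, ?_⟩
    · rw [if_pos hc, Measure.add_apply, hatom]
      simp
    · intro κ μ hκ hlim hμ hμ0 hs f hf ⟨B, hB⟩
      obtain ⟨hint, hsum⟩ := hfin κ μ hμ hs
      have hfR : Continuous fun x => (f x : ℝ) := by fun_prop
      have hBR : ∀ x, |(f x : ℝ)| ≤ B := fun x => by simpa using hB x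
      have hdom : ∀ (g : ℝ → ℝ) (B : ℝ≥0), Continuous g → (∀ x, |g x| ≤ B) →
          Tendsto (fun s => ∫ x, g x * boseFactor β (-s) x ∂ν) (𝓝[>] 0)
            (𝓝 (∫ x, g x * boseFactor β 0 x ∂ν)) := by
        intro g B hg hgB
        refine tendsto_integral_filter_of_dominated_convergence (fun x => B * boseFactor β 0 x)
          (Eventually.of_forall fun s => ?_) ?_ (hi.const_mul _) ?_
        · exact (hg.measurable.mul (measurable_boseFactor _ _)).aestronglyMeasurable
        · filter_upwards [self_mem_nhdsWithin] with s hs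
          have hs : 0 < s := hs
          filter_upwards [hpos] with x hx
          rw [norm_mul, Real.norm_eq_abs, Real.norm_of_nonneg
            (boseFactor_nonneg hβ (by linarith))]
          exact mul_le_mul (hgB x) (boseFactor_mono hβ (by linarith) hx)
            (boseFactor_nonneg hβ (by linarith)) B.coe_nonneg
        · filter_upwards [hpos] with x hx
          refine Tendsto.const_mul _ ?_
          have h1 : Tendsto (fun s : ℝ => -s) (𝓝[>] 0) (𝓝 0) := by
            simpa using (continuous_neg.tendsto (0 : ℝ)).mono_left nhdsWithin_le_nhds
          exact (continuousAt_boseFactor hβ hx).tendsto.comp h1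
      have hone : Tendsto (fun s => ∫ x, boseFactor β (-s) x ∂ν) (𝓝[>] 0)
          (𝓝 (∫ x, boseFactor β 0 x ∂ν)) := by
        simpa using hdom (fun _ => 1) 1 continuous_const (by simp)
      have hρc : ∀ μ₀ < 0, ∫ x, boseFactor β μ₀ x ∂ν ≤ ρ := by
        intro μ₀ hμ₀
        refine le_trans (integral_mono_ae (h.integrable_boseFactor hβ hμ₀) hi ?_) hle
        filter_upwards [hpos] with x hx
        exact boseFactor_mono hβ hμ₀.le hx
      have hT := tendsto_of_supercritical hκ hlim hβ hρ.le hμ hμ0 hint hsum hρc hfR hBR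
        ((hdom _ B hfR hBR).add ((hone.const_sub ρ).const_mul _))
      have hval : ∫⁻ x, f x ∂(ν.withDensity (fun x => ENNReal.ofReal (boseFactor β 0 x))
            + (ENNReal.ofReal ρ - criticalDensity β ν) • Measure.dirac 0)
          = ENNReal.ofReal (∫ x, f x * boseFactor β 0 x ∂ν
            + f 0 * (ρ - ∫ x, boseFactor β 0 x ∂ν)) := by
        rw [lintegral_add_measure, hden 0 f hf, lintegral_mul_boseFactor hβ hpos hi hf hB,
          lintegral_smul_measure, lintegral_dirac, ENNReal.ofReal_add,
          ENNReal.ofReal_mul (f 0).coe_nonneg, ENNReal.ofReal_coe_nnreal,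
          ENNReal.ofReal_sub _ (integral_nonneg_of_ae hnn), hz', smul_eq_mul, mul_comm (f 0 : ℝ≥0∞)]
        · refine integral_nonneg_of_ae ?_
          filter_upwards [hnn] with x hx
          exact mul_nonneg (f x).coe_nonneg hx
        · exact mul_nonneg (f 0).coe_nonneg (sub_nonneg.2 hle)
      rw [hval]
      simp_rw [fun n => lintegral_mul_boseFactor hβ (hμ n) (hint n) hf hB]
      exact ENNReal.tendsto_ofReal hT
  · obtain ⟨μ₀, hμ₀, hρ₀⟩ := h.exists_integral_boseFactor_eq hβ hρ (not_le.1 hc)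
    refine ⟨ν.withDensity fun x => ENNReal.ofReal (boseFactor β μ₀ x), ?_, ?_⟩
    · rw [if_neg hc, hatom]
    · intro κ μ hκ hlim hμ hμ0 hs f hf ⟨B, hB⟩
      obtain ⟨hint, hsum⟩ := hfin κ μ hμ hs
      have hfR : Continuous fun x => (f x : ℝ) := by fun_prop
      have hT := tendsto_of_subcritical hκ hlim hβ hμ hint hsum hμ₀ hρ₀ hfR (B := B)
        fun x => by simpa using hB x
      rw [hden μ₀ f hf, lintegral_mul_boseFactor hβ
        (h.ae_nonneg.mono fun x hx => hμ₀.trans_le hx) (h.integrable_boseFactor hβ hμ₀) hf hB]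
      simp_rw [fun n => lintegral_mul_boseFactor hβ (hμ n) (hint n) hf hB]
      exact ENNReal.tendsto_ofReal hT

end HeatBound

/-! ### The finite-volume gas -/

/-- The finite-volume density of states `V_l⁻¹ ∑ δ_{E_i}`. -/
def densityOfStates (d l : ℕ) (E : ℕ → ℝ) : Measure ℝ :=
  (vol d l)⁻¹ • Measure.map E Measure.count

lemma densityOfStates_Iic (d l : ℕ) (E : ℕ → ℝ) (x : ℝ) :
    densityOfStates d l E (Iic x) = finiteIDS d l E x := by
  rw [densityOfStates, Measure.smul_apply, Measure.map_apply (measurable_from_nat) measurableSet_Iic,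
    Measure.count_apply (measurable_from_nat measurableSet_Iic), finiteIDS, smul_eq_mul, mul_comm,
    div_eq_mul_inv]
  rfl

lemma lintegral_densityOfStates (d l : ℕ) (E : ℕ → ℝ) {g : ℝ → ℝ≥0∞} (hg : Measurable g) :
    ∫⁻ x, g x ∂(densityOfStates d l E) = ∑' i, g (E i) / vol d l := by
  rw [densityOfStates, lintegral_smul_measure, lintegral_map hg measurable_from_nat,
    lintegral_count, smul_eq_mul, ← ENNReal.tsum_mul_left]
  refine tsum_congr fun i => ?_
  rw [mul_comm, div_eq_mul_inv]

lemma vol_ne_zero (d : ℕ) {l : ℕ} (hl : 1 ≤ l) : vol d l ≠ 0 := by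
  have : l ≠ 0 := by omega
  simp [vol, this]

lemma ae_densityOfStates {d l : ℕ} {E : ℕ → ℝ} {s : Set ℝ} (hs : MeasurableSet s)
    (h : ∀ i, E i ∈ s) : ∀ᵐ x ∂(densityOfStates d l E), x ∈ s := by
  have : ∀ᵐ x ∂(Measure.map E Measure.count), x ∈ s :=
    (ae_map_iff (measurable_from_nat.aemeasurable) hs).2 (Eventually.of_forall h)
  exact Measure.ae_smul_measure this _

lemma IsEigenbasis.heatBound {d l : ℕ} (hl : 1 ≤ l) {V : EuclideanSpace ℝ (Fin d) → ℝ}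
    (hV : ∀ x, 0 ≤ V x) {φ : ℕ → OneParticle d l} {E : ℕ → ℝ} (h : IsEigenbasis V φ E) :
    HeatBound (heatConst d) (densityOfStates d l E) := by
  refine ⟨fun t ht => ?_, ?_, fun t ht => ?_⟩
  · have := Real.pi_pos
    unfold heatConst
    positivity
  · have h1 := ae_densityOfStates (d := d) (l := l) measurableSet_Ici
      (fun i => show E i ∈ Ici (0 : ℝ) from h.eigenvalue_nonneg hV i)
    rw [ae_iff] at h1
    simpa using! h1
  · rw [lintegral_densityOfStates d l E (by fun_prop)]
    simp_rw [div_eq_mul_inv]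
    -- The bound `1 ≤ l` is needed here: the volume must be nonzero to be moved across the
    -- inequality.
    rw [ENNReal.tsum_mul_right, ← div_eq_mul_inv,
      ENNReal.div_le_iff' (vol_ne_zero d hl) (vol_ne_top d l)]
    exact h.tsum_exp_le hV ht

/-- The consequences of the density equation for the one-particle occupation numbers. -/
lemma IsChemicalPotential.properties {d l : ℕ} {β ρ : ℝ} (hβ : 0 < β) (hρ : 0 < ρ)
    {E : ℕ → ℝ} {μ : ℝ} (hE : Monotone E) (h : IsChemicalPotential d l β ρ E μ) :
    (∀ i, μ < E i) ∧ ∑' n, boltzmann β E μ n ≠ ∞ ∧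
      ∑' i, ENNReal.ofReal (boseFactor β μ (E i)) / vol d l = ENNReal.ofReal ρ := by
  have hμ : ∀ i, μ < E i := fun i => h.1.trans_le (hE (Nat.zero_le i))
  have hZ : ∑' n, boltzmann β E μ n ≠ ∞ := by
    refine tsum_boltzmann_ne_top fun h0 => ?_
    have h1 := h.2
    rw [h0, ENNReal.zero_div] at h1
    exact (ENNReal.ofReal_pos.2 hρ).ne h1
  refine ⟨hμ, hZ, ?_⟩
  rw [← h.2, meanNumber_eq hZ fun i => mul_pos hβ (sub_pos.2 (hμ i))]
  simp_rw [div_eq_mul_inv]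
  rw [ENNReal.tsum_mul_right]

section Occupation

variable {d l : ℕ} {β μ : ℝ} {φ : ℕ → OneParticle d l} {E : ℕ → ℝ}

lemma lintegral_occupationMeasure (χ : ℕ → OneParticle d l) (e : ℕ → ℝ) (f : ℝ → ℝ≥0∞) :
    ∫⁻ x, f x ∂(occupationMeasure β φ E μ χ e)
      = ∑' k, meanOccupation β φ E μ (χ k) / vol d l * f (e k) := by
  rw [occupationMeasure, lintegral_sum_measure]
  refine tsum_congr fun k => ?_
  rw [lintegral_smul_measure, lintegral_dirac, smul_eq_mul]

/-- This puts `m_l` in the form handled by `HeatBound.exists_limit`. -/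
lemma lintegral_occupationMeasure_self (hβ : 0 < β) (hμ : ∀ i, μ < E i)
    (hZ : ∑' n, boltzmann β E μ n ≠ ∞) (hφ : Orthonormal ℂ φ) {f : ℝ → ℝ≥0∞}
    (hf : Measurable f) :
    ∫⁻ x, f x ∂(occupationMeasure β φ E μ φ E)
      = ∫⁻ x, f x * ENNReal.ofReal (boseFactor β μ x) ∂(densityOfStates d l E) := by
  rw [lintegral_occupationMeasure, lintegral_densityOfStates d l E
    (g := fun x => f x * ENNReal.ofReal (boseFactor β μ x)) (hf.mul (measurable_boseFactor β μ).ennreal_ofReal)]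
  refine tsum_congr fun i => ?_
  rw [meanOccupation_eigenfunction hZ (fun i => mul_pos hβ (sub_pos.2 (hμ i))) hφ,
    div_eq_mul_inv, div_eq_mul_inv]
  ring

/-- Exchange of the sums over the two eigenbases. -/
lemma lintegral_occupationMeasure_eq (hβ : 0 < β) (hμ : ∀ i, μ < E i)
    (hZ : ∑' n, boltzmann β E μ n ≠ ∞) (χ : ℕ → OneParticle d l) (e : ℕ → ℝ) (f : ℝ → ℝ≥0∞) :
    ∫⁻ x, f x ∂(occupationMeasure β φ E μ χ e)
      = ∑' i, ENNReal.ofReal (boseFactor β μ (E i)) / vol d l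
        * ∑' k, ENNReal.ofReal (‖(inner ℂ (χ k) (φ i) : ℂ)‖ ^ 2) * f (e k) := by
  rw [lintegral_occupationMeasure]
  simp_rw [meanOccupation_eq hZ (fun i => mul_pos hβ (sub_pos.2 (hμ i))), div_eq_mul_inv,
    ← ENNReal.tsum_mul_right, ← ENNReal.tsum_mul_left]
  rw [ENNReal.tsum_comm]
  refine tsum_congr fun i => tsum_congr fun k => ?_
  ring

/-- By Parseval each `φ i` distributes unit weight over the `ψ k`, so `m̃_l` has mass at most `ρ`.
This keeps vague limits finite near `0`. -/
lemma lintegral_occupationMeasure_le {ρ : ℝ} (hβ : 0 < β) (hμ : ∀ i, μ < E i)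
    (hZ : ∑' n, boltzmann β E μ n ≠ ∞)
    (hsum : ∑' i, ENNReal.ofReal (boseFactor β μ (E i)) / vol d l = ENNReal.ofReal ρ)
    (hφ : Orthonormal ℂ φ) {ψ : ℕ → OneParticle d l} {ε : ℕ → ℝ}
    (hψ : IsEigenbasis (fun _ => 0) ψ ε) {f : ℝ → ℝ≥0∞} (hf : ∀ x, f x ≤ 1) :
    ∫⁻ x, f x ∂(occupationMeasure β φ E μ ψ ε) ≤ ENNReal.ofReal ρ := by
  rw [lintegral_occupationMeasure_eq hβ hμ hZ, ← hsum]
  refine ENNReal.tsum_le_tsum fun i => ?_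
  refine mul_le_of_le_one_right' ?_
  calc ∑' k, ENNReal.ofReal (‖(inner ℂ (ψ k) (φ i) : ℂ)‖ ^ 2) * f (ε k)
      ≤ ∑' k, ENNReal.ofReal (‖(inner ℂ (φ i) (ψ k) : ℂ)‖ ^ 2) := by
        refine ENNReal.tsum_le_tsum fun k => ?_
        rw [norm_inner_symm]
        exact mul_le_of_le_one_right' (hf _)
    _ = 1 := by
        rw [tsum_norm_inner_sq_eq hψ.orthonormal hψ.complete, hφ.1 i]
        simp

/-- Occupation of low random states forces occupation of low kinetic-energy states. -/
lemma mul_lintegral_le_lintegral_kinetic (hβ : 0 < β) (hμ : ∀ i, μ < E i)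
    (hZ : ∑' n, boltzmann β E μ n ≠ ∞) {V : EuclideanSpace ℝ (Fin d) → ℝ}
    (hV : ∀ x, 0 ≤ V x) (hφ : IsEigenbasis V φ E) {ψ : ℕ → OneParticle d l} {ε : ℕ → ℝ}
    (hψ : IsEigenbasis (fun _ => 0) ψ ε) {γ δ : ℝ} (hγ : 0 < γ) {f g : ℝ → ℝ≥0∞}
    (hf : ∀ x, 0 ≤ x → x ≤ γ → 1 ≤ f x) (hg : ∀ x, g x ≤ 1) (hg' : ∀ x, δ < x → g x = 0) :
    ENNReal.ofReal (1 - δ / γ) * ∫⁻ x, g x ∂(occupationMeasure β φ E μ φ E)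
      ≤ ∫⁻ x, f x ∂(occupationMeasure β φ E μ ψ ε) := by
  rw [lintegral_occupationMeasure_eq hβ hμ hZ ψ, lintegral_occupationMeasure,
    ← ENNReal.tsum_mul_left]
  refine ENNReal.tsum_le_tsum fun i => ?_
  rw [meanOccupation_eigenfunction hZ (fun i => mul_pos hβ (sub_pos.2 (hμ i))) hφ.orthonormal,
    mul_left_comm]
  refine mul_le_mul_right ?_ _
  by_cases hi : δ < E i
  · simp [hg' _ hi]
  calc ENNReal.ofReal (1 - δ / γ) * g (E i)
      ≤ ENNReal.ofReal (1 - δ / γ) := mul_le_of_le_one_right' (hg _)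
    _ ≤ ENNReal.ofReal (1 - E i / γ) := by
        refine ENNReal.ofReal_le_ofReal ?_
        rw [not_lt] at hi
        gcongr
    _ ≤ _ := hφ.le_tsum_low_modes hV hψ hγ i
    _ ≤ _ := by
        refine ENNReal.tsum_le_tsum fun k => mul_le_mul_right ?_ _
        by_cases hk : ε k ≤ γ
        · rw [indicator_of_mem (show ε k ∈ Iic γ from hk)]
          exact hf _ (hψ.eigenvalue_nonneg (fun _ => le_rfl) k) hk
        · rw [indicator_of_notMem (show ε k ∉ Iic γ from hk)]
          exact zero_le

end Occupation

/-! ### Cut-off functions and comparison of atoms at zero -/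

/-- A trapezoidal cut-off. -/
def cutoff (γ : ℝ) (x : ℝ) : ℝ≥0 := Real.toNNReal (min 1 (2 - |x| / γ))

lemma continuous_cutoff (γ : ℝ) : Continuous (cutoff γ) := by
  unfold cutoff
  fun_prop

lemma cutoff_le_one (γ x : ℝ) : cutoff γ x ≤ 1 := by
  simp [cutoff]

lemma cutoff_eq_one {γ x : ℝ} (hγ : 0 < γ) (hx : |x| ≤ γ) : cutoff γ x = 1 := by
  have : |x| / γ ≤ 1 := (div_le_one hγ).2 hx
  rw [cutoff, min_eq_left (by linarith), Real.toNNReal_one]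

lemma cutoff_eq_zero {γ x : ℝ} (hγ : 0 < γ) (hx : 2 * γ ≤ |x|) : cutoff γ x = 0 := by
  have : 2 ≤ |x| / γ := (le_div_iff₀ hγ).2 hx
  exact Real.toNNReal_of_nonpos ((min_le_right _ _).trans (by linarith))

lemma hasCompactSupport_cutoff {γ : ℝ} (hγ : 0 < γ) : HasCompactSupport (cutoff γ) := by
  refine HasCompactSupport.of_support_subset_isCompact
    (isCompact_Icc (a := -(2 * γ)) (b := 2 * γ)) fun x hx => ?_
  rw [mem_Icc, ← abs_le]
  by_contra h
  exact hx (cutoff_eq_zero hγ (not_le.1 h).le)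

/-- The atom at zero of a vague limit point of the kinetic occupation measures. -/
lemma atom_le_of_lintegral_cutoff {m mt : Measure ℝ} {κ κt : ℕ → Measure ℝ} {R : ℝ≥0∞}
    (hR : R ≠ ∞) (hκ : WeaklyConverges κ m) (hκt : VaguelyConverges κt mt)
    (hbd : ∀ᶠ n in atTop, ∫⁻ x, cutoff 2 x ∂(κt n) ≤ R)
    (hle : ∀ γ δ : ℝ, 0 < γ → 0 < δ → ∀ᶠ n in atTop,
      ENNReal.ofReal (1 - 2 * δ / γ) * ∫⁻ x, cutoff δ x ∂(κ n) ≤ ∫⁻ x, cutoff γ x ∂(κt n)) :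
    m {0} ≤ mt {0} := by
  have hind : ∀ (μ : Measure ℝ) (γ : ℝ), 0 < γ → μ (Icc (-γ) γ) ≤ ∫⁻ x, cutoff γ x ∂μ := by
    intro μ γ hγ
    rw [← lintegral_indicator_one measurableSet_Icc]
    refine lintegral_mono fun x => ?_
    by_cases hx : x ∈ Icc (-γ) γ
    · rw [indicator_of_mem hx, cutoff_eq_one hγ (abs_le.2 hx)]
      simp
    · rw [indicator_of_notMem hx]
      exact zero_le
  have hind' : ∀ (μ : Measure ℝ) (γ : ℝ), 0 < γ →
      ∫⁻ x, cutoff γ x ∂μ ≤ μ (Icc (-(2 * γ)) (2 * γ)) := by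
    intro μ γ hγ
    rw [← lintegral_indicator_one measurableSet_Icc]
    refine lintegral_mono fun x => ?_
    by_cases hx : x ∈ Icc (-(2 * γ)) (2 * γ)
    · rw [indicator_of_mem hx]
      simpa using cutoff_le_one γ x
    · rw [indicator_of_notMem hx, cutoff_eq_zero hγ]
      · simp
      · by_contra h
        exact hx (abs_le.1 (not_le.1 h).le)
  have key : ∀ γ : ℝ, 0 < γ →
      ENNReal.ofReal (1 - 2 * γ) * m {0} ≤ mt (Icc (-(2 * γ)) (2 * γ)) := by
    intro γ hγ
    -- The scale `δ = γ²` makes the lost fraction `2δ/γ = 2γ` vanish as `γ → 0`; the factor `2` is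
    -- the support radius of `cutoff δ` in units of `δ`.
    have h1 := hκ (cutoff (γ ^ 2)) (continuous_cutoff _) ⟨1, cutoff_le_one _⟩
    have h2 := hκt (cutoff γ) (continuous_cutoff _) (hasCompactSupport_cutoff hγ)
    have h3 := le_of_tendsto_of_tendsto
      (ENNReal.Tendsto.const_mul h1 (Or.inr ENNReal.ofReal_ne_top)) h2
      (hle γ (γ ^ 2) hγ (by positivity))
    have h4 : 2 * γ ^ 2 / γ = 2 * γ := by field_simp
    rw [h4] at h3
    refine le_trans ?_ (h3.trans (hind' mt γ hγ))
    refine mul_le_mul_right ((measure_mono ?_).trans (hind m (γ ^ 2) (by positivity))) _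
    intro x hx
    rw [mem_singleton_iff.1 hx]
    exact ⟨by simpa using sq_nonneg γ, by positivity⟩
  -- Continuity from above needs one interval of finite measure; `[-2, 2]` is the first of the
  -- sequence because `γ 0 = 1`.
  have hfin : mt (Icc (-2) 2) ≠ ∞ :=
    (((hind mt 2 two_pos).trans (le_of_tendsto (hκt (cutoff 2) (continuous_cutoff _)
      (hasCompactSupport_cutoff two_pos)) hbd)).trans_lt hR.lt_top).ne
  let γ : ℕ → ℝ := fun k => 1 / ((k : ℝ) + 1)
  have hγ : ∀ k, 0 < γ k := fun k => by positivity
  have hγ0 : Tendsto γ atTop (𝓝 0) := tendsto_one_div_add_atTop_nhds_zero_nat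
  have hanti : Antitone γ := fun a b hab => one_div_le_one_div_of_le (by positivity) (by gcongr)
  have hI : ⋂ k, Icc (-(2 * γ k)) (2 * γ k) = {0} := by
    ext x
    simp only [mem_iInter, ← abs_le, mem_Icc, mem_singleton_iff]
    constructor
    · intro h
      have := ge_of_tendsto' (hγ0.const_mul 2) h
      rw [mul_zero] at this
      exact abs_nonpos_iff.1 this
    · rintro rfl k
      rw [abs_zero]
      have := hγ k
      positivity
  have hmt : Tendsto (fun k => mt (Icc (-(2 * γ k)) (2 * γ k))) atTop (𝓝 (mt {0})) := by
    rw [← hI]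
    refine tendsto_measure_iInter_atTop (fun k => measurableSet_Icc.nullMeasurableSet)
      (fun a b hab => Icc_subset_Icc ?_ ?_) ⟨0, ?_⟩
    · linarith [hanti hab]
    · linarith [hanti hab]
    · simpa [γ] using hfin
  have hm : Tendsto (fun k => ENNReal.ofReal (1 - 2 * γ k) * m {0}) atTop (𝓝 (m {0})) := by
    have h1 : Tendsto (fun k => ENNReal.ofReal (1 - 2 * γ k)) atTop (𝓝 1) := by
      simpa using ENNReal.tendsto_ofReal ((hγ0.const_mul 2).const_sub 1)
    simpa using ENNReal.Tendsto.mul_const h1 (Or.inl one_ne_zero)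
  exact le_of_tendsto_of_tendsto' hm hmt fun k => key (γ k) (hγ k)

end BoseGas

end

/-! ### Assembly of the theorem -/

theorem mainTheorem10 {d : ℕ} (hd : 1 ≤ d)
    {Ω : Type*} [MeasurableSpace Ω] (P : Measure Ω) [IsProbabilityMeasure P]
    -- the non-negative random potential
    (v : Ω → EuclideanSpace ℝ (Fin d) → ℝ)
    (hv_meas : Measurable (Function.uncurry v))
    (hv_nonneg : ∀ ω x, 0 ≤ v ω x)
    -- eigenfunctions and eigenvalues of the kinetic-energy operators
    (ψ : (l : ℕ) → ℕ → BoseGas.OneParticle d l) (ε : ℕ → ℕ → ℝ)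
    (hψ : ∀ l, 1 ≤ l → BoseGas.IsEigenbasis (fun _ => 0) (ψ l) (ε l))
    -- eigenfunctions and eigenvalues of the random operators
    (φ : (l : ℕ) → Ω → ℕ → BoseGas.OneParticle d l) (E : ℕ → Ω → ℕ → ℝ)
    (hφ : ∀ᵐ ω ∂P, ∀ l, 1 ≤ l → BoseGas.IsEigenbasis (v ω) (φ l ω) (E l ω))
    -- the bottom of the spectrum tends to zero
    (hE : ∀ᵐ ω ∂P, Tendsto (fun l => E l ω 0) atTop (𝓝 0))
    -- the limiting integrated density of states
    (ν : Measure ℝ) (hν : ∀ᵐ ω ∂P, BoseGas.IsLimitingIDS d (fun l => E l ω) ν)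
    -- inverse temperature, mean density, chemical potentials
    (β ρ : ℝ) (hβ : 0 < β) (hρ : 0 < ρ) (μ : ℕ → Ω → ℝ)
    (hμ : ∀ᵐ ω ∂P, ∀ l, 1 ≤ l → BoseGas.IsChemicalPotential d l β ρ (E l ω) (μ l ω)) :
    ∃ m : Measure ℝ,
      (∀ᵐ ω ∂P, BoseGas.WeaklyConverges
        (fun l => BoseGas.occupationMeasure β (φ l ω) (E l ω) (μ l ω) (φ l ω) (E l ω)) m) ∧
      m {0} = (if BoseGas.criticalDensity β ν ≤ ENNReal.ofReal ρ
        then ENNReal.ofReal ρ - BoseGas.criticalDensity β ν else 0) ∧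
      ∀ᵐ ω ∂P, ∀ s : ℕ → ℕ, StrictMono s → ∀ mtilde : Measure ℝ,
        BoseGas.VaguelyConverges
          (fun r => BoseGas.occupationMeasure β (φ (s r) ω) (E (s r) ω) (μ (s r) ω)
            (ψ (s r)) (ε (s r))) mtilde →
        m {0} ≤ mtilde {0} := by
  have hgood : ∀ᵐ ω ∂P, (∀ l, 1 ≤ l → BoseGas.IsEigenbasis (v ω) (φ l ω) (E l ω)) ∧
      Tendsto (fun l => E l ω 0) atTop (𝓝 0) ∧ BoseGas.IsLimitingIDS d (fun l => E l ω) ν ∧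
      ∀ l, 1 ≤ l → BoseGas.IsChemicalPotential d l β ρ (E l ω) (μ l ω) := by
    filter_upwards [hφ, hE, hν, hμ] with ω h1 h2 h3 h4
    exact ⟨h1, h2, h3, h4⟩
  have hheat : ∀ ω, (∀ l, 1 ≤ l → BoseGas.IsEigenbasis (v ω) (φ l ω) (E l ω)) → ∀ n,
      BoseGas.HeatBound (BoseGas.heatConst d) (BoseGas.densityOfStates d (n + 1) (E (n + 1) ω)) :=
    fun ω h n => (h (n + 1) (by omega)).heatBound (by omega) (hv_nonneg ω)
  have hids : ∀ ω, BoseGas.IsLimitingIDS d (fun l => E l ω) ν → ∀ x, ν {x} = 0 →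
      Tendsto (fun n => BoseGas.densityOfStates d (n + 1) (E (n + 1) ω) (Iic x)) atTop
        (𝓝 (ν (Iic x))) := by
    intro ω h x hx
    simp_rw [BoseGas.densityOfStates_Iic]
    exact (tendsto_add_atTop_iff_nat 1).2 (h.2 x hx)
  -- `ν` is deterministic, so a single good realization suffices to transfer the Laplace bound to it
  -- and to fix `m` before any other `ω` is considered.
  obtain ⟨ω₀, h₁, h₂, h₃, h₄⟩ := hgood.exists
  have : IsLocallyFiniteMeasure ν := h₃.1
  have hνheat : BoseGas.HeatBound (BoseGas.heatConst d) ν :=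
    BoseGas.HeatBound.of_tendsto (hheat ω₀ h₁) (hids ω₀ h₃)
  obtain ⟨m, hm0, hm⟩ := hνheat.exists_limit
    (hνheat.measure_singleton_zero (BoseGas.tendsto_heatConst hd)) hβ hρ
  have hweak : ∀ ω, ((∀ l, 1 ≤ l → BoseGas.IsEigenbasis (v ω) (φ l ω) (E l ω)) ∧
      Tendsto (fun l => E l ω 0) atTop (𝓝 0) ∧ BoseGas.IsLimitingIDS d (fun l => E l ω) ν ∧
      ∀ l, 1 ≤ l → BoseGas.IsChemicalPotential d l β ρ (E l ω) (μ l ω)) →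
      BoseGas.WeaklyConverges
        (fun l => BoseGas.occupationMeasure β (φ l ω) (E l ω) (μ l ω) (φ l ω) (E l ω)) m := by
    rintro ω ⟨hb, hE0, hI, hc⟩ f hf hB
    have hp := fun n : ℕ =>
      (hc (n + 1) (by omega)).properties hβ hρ (hb (n + 1) (by omega)).ordered
    have := hm (fun n => BoseGas.densityOfStates d (n + 1) (E (n + 1) ω)) (fun n => μ (n + 1) ω)
      (hheat ω hb) (hids ω hI)
      (fun n => BoseGas.ae_densityOfStates measurableSet_Ioi (hp n).1)
      -- From `μ < E 0 → 0` the chemical potentials are eventually below every positive `s`.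
      (fun s hs => by
        filter_upwards [((tendsto_add_atTop_iff_nat 1).2 hE0).eventually (gt_mem_nhds hs)]
          with n hn
        exact (hc (n + 1) (by omega)).1.trans hn)
      (fun n => by
        rw [BoseGas.lintegral_densityOfStates _ _ _
          (BoseGas.measurable_boseFactor _ _).ennreal_ofReal]
        exact (hp n).2.2) f hf hB
    -- Nothing is assumed about the empty cube `l = 0`, hence the shift to `l = n + 1`.
    rw [← tendsto_add_atTop_iff_nat 1]
    refine this.congr fun n => ?_
    exact (BoseGas.lintegral_occupationMeasure_self hβ (hp n).1 (hp n).2.1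
      (hb (n + 1) (by omega)).orthonormal (by fun_prop)).symm
  refine ⟨m, hgood.mono hweak, hm0, ?_⟩
  filter_upwards [hgood] with ω hω s hs mtilde hv
  have hlim : BoseGas.WeaklyConverges (fun r => BoseGas.occupationMeasure β (φ (s r) ω)
      (E (s r) ω) (μ (s r) ω) (φ (s r) ω) (E (s r) ω)) m := fun f hf hB =>
    (hweak ω hω f hf hB).comp hs.tendsto_atTop
  obtain ⟨hb, -, -, hc⟩ := hω
  have hs1 : ∀ᶠ r in atTop, 1 ≤ s r := hs.tendsto_atTop.eventually_ge_atTop 1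
  refine BoseGas.atom_le_of_lintegral_cutoff (ENNReal.ofReal_ne_top (r := ρ)) hlim hv ?_ ?_
  · filter_upwards [hs1] with r hr
    obtain ⟨h1, h2, h3⟩ := (hc (s r) hr).properties hβ hρ (hb (s r) hr).ordered
    exact BoseGas.lintegral_occupationMeasure_le hβ h1 h2 h3 (hb (s r) hr).orthonormal
      (hψ (s r) hr) fun x => by exact_mod_cast BoseGas.cutoff_le_one 2 x
  · intro γ δ hγ hδ
    filter_upwards [hs1] with r hr
    obtain ⟨h1, h2, -⟩ := (hc (s r) hr).properties hβ hρ (hb (s r) hr).ordered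
    refine BoseGas.mul_lintegral_le_lintegral_kinetic hβ h1 h2 (hv_nonneg ω) (hb (s r) hr)
      (hψ (s r) hr) hγ ?_ ?_ ?_
    · intro x hx hxγ
      rw [BoseGas.cutoff_eq_one hγ (by rwa [abs_of_nonneg hx])]
      simp
    · intro x
      exact_mod_cast BoseGas.cutoff_le_one δ x
    · intro x hx
      rw [BoseGas.cutoff_eq_zero hδ (hx.le.trans (le_abs_self x)), ENNReal.coe_zero]
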